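/- Let $S$ be a noetherian scheme and let $f : X \to S$ be an $S$-scheme with $X$ integral and noetherian. Let $\mathcal{A}_1,\mathcal{A}_2$ be graded quasi-coherent (commutative, $\mathbb{Z}_{\ge 0}$-graded) $\mathcal{O}_S$-algebras such that for $i=1,2$: the degree $0$ part of $\mathcal{A}_i$ is $\mathcal{O}_S$ (via the structure map); the degree $1$ part $(\mathcal{A}_i)_1$ is a coherent $\mathcal{O}_S$-module; and $\mathcal{A}_i$ is locally generated by its degree $1$ part as an $\mathcal{O}_S$-algebra. Put $Y_i=\mathbf{Proj}(\mathcal{A}_i)$. For $i=1,2$ let $\mathcal{L}_i$ be an invertible $\mathcal{O}_X$-module and let $\psi_i : f^*\mathcal{A}_i \to \bigoplus_{n\ge 0}\mathcal{L}_i^{\otimes n}$ be a homomorphism of graded $\mathcal{O}_X$-algebras whose degree $1$ part $(f^*\mathcal{A}_i)_1\to\mathcal{L}_i$ is surjective. Let $\varphi_i : X \to Y_i$ be the $S$-morphism induced by $(\mathcal{L}_i,\psi_i)$, that is, the composite $X=\mathbf{Proj}(\bigoplus_n\mathcal{L}_i^{\otimes n})\to\mathbf{Proj}(f^*\mathcal{A}_i)=Y_i\times_S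 X\to Y_i$; explicitly, for $U\subseteq S$ affine open, $a\in(\mathcal{A}_i)_1(U)$ and $W\subseteq f^{-1}(U)$ open such that $\psi_i(f^*a)$ generates $\mathcal{L}_i$ on $W$, the morphism $\varphi_i|_W$ maps into $D_+(a)=\mathrm{Spec}\,\mathcal{A}_i(U)_{(a)}$ and is given by $b/a^n\mapsto\psi_i(f^*b)/\psi_i(f^*a)^{\otimes n}$. Let $\xi:\mathcal{A}_2\to\mathcal{A}_1$ be a morphism of graded $\mathcal{O}_S$-algebras. Let $\mathbf{G}(\xi)\subseteq Y_1$ be the (possibly empty) open subscheme which is the union of the $D_+(\xi(a))$ for $a$ a homogeneous section of $\mathcal{A}_2$ of positive degree over an affine open subset of $S$, and let $\mathbf{P}(\xi):\mathbf{G}(\xi)\to Y_2$ be the induced morphism, given on $D_+(\xi(a))$ by the ring homomorphism $\mathcal{A}_2(U)_{(a)}\to\mathcal{A}_1(U)_{(\xi(a))}$ defined by $\xi$. Then $\mathbf{P}(\xi)\circ\varphi_1=\varphi_2$ on $\varphi_1^{-1}(\mathbf{G}(\xi))$ if and only if there exists $s\in\mathrm{Hom}_{\mathcal{O}_X}(\mathcal{L}_2,\mathcal{L}_1)$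 such that $\psi_1\circ f^*\xi=s\circ\psi_2$ as morphisms $(f^*\mathcal{A}_2)_1\to\mathcal{L}_1$. -/

import Mathlib

open CategoryTheory AlgebraicGeometry

universe u

noncomputable section

open HomogeneousLocalization Graded HomogeneousIdeal
open scoped DirectSum

namespace GradedLoc
variable {A B σ τ : Type u} [CommRing A] [SetLike σ A] [AddSubgroupClass σ A]
  [CommRing B] [SetLike τ B] [AddSubgroupClass τ B]
  {𝒜 : ℕ → σ} {ℬ : ℕ → τ} [GradedRing 𝒜] [GradedRing ℬ]

/-- The graded ring `ℬ` is the localization of the graded ring `𝒜` at the degree zero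
element `f`. -/
structure IsAway (g : 𝒜 →+*ᵍ ℬ) (f : A) : Prop where
  mem : f ∈ 𝒜 0
  inv : ∃ v ∈ ℬ 0, g f * v = 1
  surj : ∀ n, ∀ b ∈ ℬ n, ∃ k : ℕ, ∃ a ∈ 𝒜 n, g f ^ k * b = g a
  inj : ∀ n, ∀ a ∈ 𝒜 n, g a = 0 → ∃ k : ℕ, f ^ k * a = 0

variable {g : 𝒜 →+*ᵍ ℬ} {f : A}

theorem IsAway.irrelevant (h : IsAway g f) : ℬ₊ ≤ 𝒜₊.map g := by
  obtain ⟨v, hv, hfv⟩ := h.inv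
  rw [HomogeneousIdeal.irrelevant_le]
  intro i hi b hb
  obtain ⟨k, a, ha, hab⟩ := h.surj i b hb
  have hb' : b = v ^ k * g a := by
    rw [← hab, ← mul_assoc, ← mul_pow, mul_comm v, hfv, one_pow, one_mul]
  have : a ∈ 𝒜₊ := HomogeneousIdeal.mem_irrelevant_of_mem _ hi ha
  change b ∈ (𝒜₊.map g).toIdeal
  rw [hb']
  exact Ideal.mul_mem_left _ _ (Ideal.mem_map_of_mem _ this)

/-- The fraction `f / 1` in `𝒜_(s)`. -/
def frac (h : IsAway g f) {d : ℕ} {s : A} (hs : s ∈ 𝒜 d) : Away 𝒜 s :=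
  Away.mk 𝒜 hs 0 f (by simpa using h.mem)

theorem IsAway.isLocalization (h : IsAway g f) {d : ℕ} {s : A} (hs : s ∈ 𝒜 d) :
    letI := (Away.map g s).toAlgebra
    IsLocalization.Away (frac h hs) (Away ℬ (g s)) := by
  let _ := (Away.map g s).toAlgebra
  obtain ⟨v, hv, hfv⟩ := h.inv
  have hpow : ∀ k : ℕ, g f ^ k * v ^ k = 1 := fun k ↦ by rw [← mul_pow, hfv, one_pow]
  refine IsLocalization.Away.mk _ ?_ ?_ ?_
  · refine isUnit_iff_exists_inv.mpr ⟨Away.mk ℬ (map_mem g hs) 0 v (by simpa using hv), ?_⟩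
    ext
    simp [RingHom.algebraMap_toAlgebra, frac, Away.val_mk, Localization.mk_mul, hfv]
  · intro z
    obtain ⟨n, b, hb, rfl⟩ := Away.mk_surjective ℬ (map_mem g hs) z
    obtain ⟨k, a, ha, hab⟩ := h.surj _ b hb
    refine ⟨k, Away.mk 𝒜 hs n a ha, ?_⟩
    ext
    simp only [RingHom.algebraMap_toAlgebra, frac, Away.val_mk, Away.map_mk, val_mul, val_pow,
      Localization.mk_mul, Localization.mk_pow, ← hab]
    rw [Localization.mk_eq_mk_iff, Localization.r_iff_exists]
    exact ⟨1, by simp; ring⟩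
  · intro a b e
    obtain ⟨n, a, ha, rfl⟩ := Away.mk_surjective 𝒜 hs a
    obtain ⟨m, b, hb, rfl⟩ := Away.mk_surjective 𝒜 hs b
    replace e := congr_arg val e
    simp only [RingHom.algebraMap_toAlgebra, Away.map_mk, Away.val_mk,
      Localization.mk_eq_mk_iff, Localization.r_iff_exists] at e
    obtain ⟨⟨_, k, rfl⟩, hc⟩ := e
    have h1 : s ^ k * (s ^ m * a - s ^ n * b) ∈ 𝒜 (k * d + (m * d + n * d)) := by
      have hp : ∀ j, s ^ j ∈ 𝒜 (j * d) := fun j ↦ SetLike.pow_mem_graded j hs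
      refine SetLike.mul_mem_graded (hp k) (sub_mem (SetLike.mul_mem_graded (hp m) ha) ?_)
      rw [add_comm]
      exact SetLike.mul_mem_graded (hp n) hb
    obtain ⟨l, hl⟩ := h.inj _ _ h1 (by
      simp only [map_mul, map_sub, map_pow]
      simp only at hc
      rw [mul_sub, hc, sub_self])
    refine ⟨l, ?_⟩
    ext
    simp only [val_mul, val_pow, frac, Away.val_mk, Localization.mk_pow,
      Localization.mk_eq_mk_iff, Localization.r_iff_exists, Localization.mk_mul]
    refine ⟨⟨_, k, rfl⟩, ?_⟩
    simp
    linear_combination hl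

theorem isPullback_away (h : IsAway g f) {n : ℕ} (hn : 0 < n) {s : A} (hs : s ∈ 𝒜 n) :
    IsPullback (Proj.awayι ℬ (g s) (map_mem g hs) hn)
      (Spec.map (CommRingCat.ofHom (Away.map g s)))
      (Proj.map g h.irrelevant) (Proj.awayι 𝒜 s hs hn) :=
  (IsOpenImmersion.isPullback _ _ _ _ (Proj.awayι_comp_map g h.irrelevant hn s hs) (by
    rw [Proj.opensRange_awayι, Proj.opensRange_awayι, Proj.map_preimage_basicOpen])).flip

theorem IsAway.isOpenImmersion (h : IsAway g f) :
    IsOpenImmersion (Proj.map g h.irrelevant) := by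
  refine (IsZariskiLocalAtTarget.iff_of_openCover (P := @IsOpenImmersion)
    (Proj.affineOpenCover 𝒜).openCover).mpr fun (i : Σ i : PNat, 𝒜 i) ↦ ?_
  have hpb := isPullback_away h i.1.2 i.2.2
  have h2 : IsOpenImmersion (Spec.map (CommRingCat.ofHom (Away.map g i.2.1))) := by
    let _ := (Away.map g i.2.1).toAlgebra
    have := h.isLocalization i.2.2
    exact IsOpenImmersion.of_isLocalization (frac h i.2.2)
  rw [← hpb.isoPullback_hom_snd] at h2
  exact (MorphismProperty.cancel_left_of_respectsIso @IsOpenImmersion hpb.isoPullback.hom _).mp h2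

theorem IsAway.opensRange (h : IsAway g f) :
    haveI := h.isOpenImmersion
    (Proj.map g h.irrelevant).opensRange = Proj.basicOpen 𝒜 f := by
  have := h.isOpenImmersion
  apply le_antisymm
  · rintro _ ⟨y, rfl⟩
    change g f ∉ y.asHomogeneousIdeal
    obtain ⟨v, hv, hfv⟩ := h.inv
    intro hy
    apply y.isPrime.ne_top
    rw [Ideal.eq_top_iff_one, ← hfv]
    exact Ideal.mul_mem_right _ _ hy
  · intro x hx
    have hx' : f ∉ x.asHomogeneousIdeal := hx
    obtain ⟨n, s, hn, hs, hsx⟩ : ∃ (n : ℕ) (s : A), 0 < n ∧ s ∈ 𝒜 n ∧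
        s ∉ x.asHomogeneousIdeal := by
      by_contra! H
      exact x.not_irrelevant_le ((HomogeneousIdeal.irrelevant_le _).mpr fun i hi a ha ↦ H i a hi ha)
    have hfs : f * s ∈ 𝒜 n := by simpa using SetLike.mul_mem_graded h.mem hs
    have hxs : x ∈ (Proj.awayι 𝒜 (f * s) hfs hn).opensRange := by
      rw [Proj.opensRange_awayι]
      intro hc
      exact (x.isPrime.mem_or_mem hc).elim hx' hsx
    obtain ⟨y, rfl⟩ := hxs
    have hu : IsUnit (frac h hfs) := by
      refine isUnit_iff_exists_inv.mpr ⟨Away.mk 𝒜 hfs 1 s (by simpa using hs), ?_⟩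
      ext
      simp [frac, Away.val_mk, Localization.mk_mul]
    let _ := (Away.map g (f * s)).toAlgebra
    have := h.isLocalization hfs
    have hr : y ∈ Set.range (PrimeSpectrum.comap (Away.map g (f * s))) := by
      have := PrimeSpectrum.localization_away_comap_range (Away ℬ (g (f * s))) (frac h hfs)
      have hy : y ∈ (PrimeSpectrum.basicOpen (frac h hfs)).1 := fun hc ↦ y.isPrime.ne_top (Ideal.eq_top_of_isUnit_mem _ hc hu)
      exact this.ge hy
    obtain ⟨z, rfl⟩ := hr
    refine ⟨Proj.awayι ℬ (g (f * s)) (map_mem g hfs) hn z, ?_⟩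
    have := Proj.awayι_comp_map g h.irrelevant hn (f * s) hfs
    exact congr($this z)
end GradedLoc

namespace ExtGraded
variable (M N : ℕ → Type u) [∀ n, AddCommGroup (M n)] [∀ n, AddCommGroup (N n)]
  [DirectSum.GCommRing M] [DirectSum.GCommRing N]

/-- The homogeneous part of degree `n` of `⨁ n, M n`. -/
def part (n : ℕ) : AddSubgroup (⨁ n, M n) := (DirectSum.of M n).range

variable {M N} in
theorem of_mem {n : ℕ} (a : M n) : DirectSum.of M n a ∈ part M n := ⟨a, rfl⟩

/-- The inclusion of `M n` as the homogeneous part of degree `n`. -/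
def toPart (n : ℕ) : M n →+ part M n where
  toFun a := ⟨DirectSum.of M n a, of_mem a⟩
  map_zero' := by ext1; exact map_zero _
  map_add' a b := by ext1; exact map_add _ a b

instance gradedRing : GradedRing (part M) where
  one_mem := ⟨_, rfl⟩
  mul_mem := by
    rintro m n _ _ ⟨a, rfl⟩ ⟨b, rfl⟩
    exact ⟨_, (DirectSum.of_mul_of a b).symm⟩
  decompose' := DirectSum.toAddMonoid fun n ↦
    (DirectSum.of (fun n ↦ part M n) n).comp (toPart M n)
  left_inv x := by
    induction x using DirectSum.induction_on with
    | zero => rw [map_zero, map_zero]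
    | of n x =>
      rw [DirectSum.toAddMonoid_of, AddMonoidHom.comp_apply, DirectSum.coeAddMonoidHom_of]
      rfl
    | add x y hx hy => rw [map_add, map_add, hx, hy]
  right_inv x := by
    induction x using DirectSum.induction_on with
    | zero => rw [map_zero, map_zero]
    | of n x =>
      obtain ⟨_, x, rfl⟩ := x
      rw [DirectSum.coeAddMonoidHom_of, DirectSum.toAddMonoid_of]
      rfl
    | add x y hx hy => rw [map_add, map_add, hx, hy]

variable {M N}

/-- The graded ring homomorphism with given components. -/
def mapHom (h : ∀ n, M n →+ N n)
    (h_one : h 0 GradedMonoid.GOne.one = GradedMonoid.GOne.one)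
    (h_mul : ∀ {m n : ℕ} (a : M m) (b : M n), h (m + n) (GradedMonoid.GMul.mul a b) =
      GradedMonoid.GMul.mul (h m a) (h n b)) : part M →+*ᵍ part N where
  toRingHom := DirectSum.toSemiring (fun n ↦ (DirectSum.of N n).comp (h n))
    (by rw [AddMonoidHom.comp_apply, h_one]; rfl)
    (fun a b ↦ by
      rw [AddMonoidHom.comp_apply, h_mul, AddMonoidHom.comp_apply, AddMonoidHom.comp_apply,
        DirectSum.of_mul_of])
  map_mem := by
    rintro n _ ⟨a, rfl⟩
    exact ⟨h n a, (DirectSum.toAddMonoid_of (fun n ↦ (DirectSum.of N n).comp (h n)) n a).symm⟩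

theorem mapHom_of (h : ∀ n, M n →+ N n) (h_one) (h_mul) {n : ℕ} (a : M n) :
    mapHom h h_one h_mul (DirectSum.of M n a) = DirectSum.of N n (h n a) :=
  DirectSum.toAddMonoid_of (fun n ↦ (DirectSum.of N n).comp (h n)) n a

theorem hom_ext {f g : part M →+*ᵍ part N}
    (h : ∀ n (a : M n), f (DirectSum.of M n a) = g (DirectSum.of M n a)) : f = g := by
  have : f.toRingHom = g.toRingHom := DirectSum.ringHom_ext h
  exact DFunLike.ext _ _ fun x ↦ congr($this x)

end ExtGraded

/-- A graded quasi-coherent (commutative) `𝒪_S`-algebra `⨁ n, A_n`: quasi-coherent `𝒪_S`-modules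
`deg n`, an `𝒪_S`-bilinear graded ring structure on the sections over every open set, compatible
with restriction. The structure map `𝒪_S ⟶ A_0` is `r ↦ r • 1`. -/
structure GradedQCohAlg (S : Scheme.{u}) where
  deg : ℕ → S.Modules
  isQuasicoherent (n : ℕ) : (deg n).IsQuasicoherent
  gring (U : S.Opens) : DirectSum.GCommRing fun n ↦ Γ(deg n, U)
  smul_mul {U : S.Opens} {m n : ℕ} (r : Γ(S, U)) (a : Γ(deg m, U)) (b : Γ(deg n, U)) :
    GradedMonoid.GMul.mul (A := fun n ↦ Γ(deg n, U)) (r • a) b =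
      r • GradedMonoid.GMul.mul (A := fun n ↦ Γ(deg n, U)) a b
  res_one {U V : S.Opens} (i : V ⟶ U) : (deg 0).presheaf.map i.op
    (GradedMonoid.GOne.one (A := fun n ↦ Γ(deg n, U))) =
      GradedMonoid.GOne.one (A := fun n ↦ Γ(deg n, V))
  res_mul {U V : S.Opens} (i : V ⟶ U) {m n : ℕ} (a : Γ(deg m, U)) (b : Γ(deg n, U)) :
    (deg (m + n)).presheaf.map i.op (GradedMonoid.GMul.mul (A := fun n ↦ Γ(deg n, U)) a b) =
      GradedMonoid.GMul.mul (A := fun n ↦ Γ(deg n, V))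
        ((deg m).presheaf.map i.op a) ((deg n).presheaf.map i.op b)

namespace GradedQCohAlg
variable {S : Scheme.{u}} (A : GradedQCohAlg S)

/-- The sections of the degree `n` part over `U`. -/
abbrev piece (U : S.Opens) (n : ℕ) : Type u := Γ(A.deg n, U)

instance (U : S.Opens) : DirectSum.GCommRing (A.piece U) := A.gring U

/-- The graded ring `⨁ n, A_n(U)`. -/
abbrev Sec (U : S.Opens) : Type u := ⨁ n, A.piece U n

/-- The homogeneous part of degree `n` of `⨁ n, A_n(U)`. -/
abbrev part (U : S.Opens) : ℕ → AddSubgroup (A.Sec U) := ExtGraded.part (A.piece U)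

/-- The inclusion of the sections of `A_n` into `⨁ n, A_n(U)`. -/
abbrev of (U : S.Opens) (n : ℕ) : A.piece U n →+ A.Sec U := DirectSum.of (A.piece U) n

theorem of_smul_aux {U : S.Opens} (r : Γ(S, U)) {m n : ℕ} (x : A.piece U m) (y : A.piece U n)
    (h : (⟨m, x⟩ : GradedMonoid (A.piece U)) = ⟨n, y⟩) : A.of U m (r • x) = A.of U n (r • y) := by
  cases h; rfl

theorem of_smul_one_mul {U : S.Opens} (r : Γ(S, U)) {n : ℕ} (x : A.piece U n) :
    A.of U 0 (r • GradedMonoid.GOne.one (A := A.piece U)) * A.of U n x = A.of U n (r • x) := by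
  rw [DirectSum.of_mul_of, A.smul_mul]
  exact A.of_smul_aux r _ _ (one_mul (M := GradedMonoid (A.piece U)) ⟨n, x⟩)

/-- The structure map `𝒪_S(U) → ⨁ n, A_n(U)`. -/
def algMap (U : S.Opens) : Γ(S, U) →+* A.Sec U where
  toFun r := A.of U 0 (r • GradedMonoid.GOne.one (A := A.piece U))
  map_one' := by rw [one_smul]; rfl
  map_zero' := by rw [zero_smul, map_zero]
  map_add' r s := by rw [add_smul, map_add]
  map_mul' r s := by rw [of_smul_one_mul, mul_smul]

theorem algMap_mul_of {U : S.Opens} (r : Γ(S, U)) {n : ℕ} (x : A.piece U n) :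
    A.algMap U r * A.of U n x = A.of U n (r • x) := A.of_smul_one_mul r x

/-- Restriction of sections, as a graded ring homomorphism. -/
def res {U V : S.Opens} (i : V ⟶ U) : A.part U →+*ᵍ A.part V :=
  ExtGraded.mapHom (fun n ↦ ((A.deg n).presheaf.map i.op).hom) (A.res_one i) (A.res_mul i)

theorem res_of {U V : S.Opens} (i : V ⟶ U) {n : ℕ} (a : A.piece U n) :
    A.res i (A.of U n a) = A.of V n ((A.deg n).presheaf.map i.op a) :=
  ExtGraded.mapHom_of _ _ _ _

theorem res_id (U : S.Opens) : A.res (𝟙 U) = .id _ := by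
  refine ExtGraded.hom_ext fun n a ↦ ?_
  rw [res_of]
  simp

theorem res_comp {U V W : S.Opens} (i : V ⟶ U) (j : W ⟶ V) :
    A.res (j ≫ i) = (A.res j).comp (A.res i) := by
  refine ExtGraded.hom_ext fun n a ↦ ?_
  rw [res_of]
  change _ = A.res j (A.res i (A.of U n a))
  rw [res_of, res_of]
  simp

theorem res_algMap {U V : S.Opens} (i : V ⟶ U) (r : Γ(S, U)) :
    A.res i (A.algMap U r) = A.algMap V (S.presheaf.map i.op r) := by
  change A.res i (A.of U 0 _) = A.of V 0 _
  rw [res_of, Scheme.Modules.map_smul, A.res_one]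

end GradedQCohAlg

namespace QCoh
theorem spec_surj {R : CommRingCat.{u}} (N : (Spec R).Modules) [N.IsQuasicoherent] (f : R)
    (D : (Spec R).Opens) (hD : D = PrimeSpectrum.basicOpen f) (b : Γ(N, D)) :
    ∃ (k : ℕ) (a : Γ(N, ⊤)), f ^ k • b =
      N.presheaf.map (homOfLE (le_top : D ≤ ⊤)).op a := by
  subst hD
  have h := (isIso_fromTildeΓ_iff_isLocalizing N).mp inferInstance f
  let φ := ((modulesSpecToSheaf.obj N).obj.map (PrimeSpectrum.basicOpen f).leTop.op).hom
  have hf : IsLocalizedModule.Away f φ := h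
  obtain ⟨n, y, hy⟩ := hf.surj _ _ b
  exact ⟨n, y, hy⟩

theorem spec_inj {R : CommRingCat.{u}} (N : (Spec R).Modules) [N.IsQuasicoherent] (f : R)
    (a : Γ(N, ⊤))
    (ha : N.presheaf.map (homOfLE (le_top : PrimeSpectrum.basicOpen f ≤ ⊤)).op a = 0) :
    ∃ k : ℕ, f ^ k • a = 0 := by
  have h := (isIso_fromTildeΓ_iff_isLocalizing N).mp inferInstance f
  let φ := ((modulesSpecToSheaf.obj N).obj.map (PrimeSpectrum.basicOpen f).leTop.op).hom
  have hf : IsLocalizedModule.Away f φ := h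
  obtain ⟨⟨_, n, rfl⟩, hn⟩ := (IsLocalizedModule.eq_zero_iff (.powers f) φ).mp ha
  exact ⟨n, hn⟩

theorem aux {S : Scheme.{u}} (M : S.Modules) [M.IsQuasicoherent] {R : CommRingCat.{u}}
    (j : Spec R ⟶ S) [IsOpenImmersion j] {U : S.Opens} (hU : j ''ᵁ ⊤ = U) (r : Γ(S, U)) :
    (∀ b : Γ(M, S.basicOpen r), ∃ (k : ℕ) (a : Γ(M, U)),
      S.presheaf.map (homOfLE (S.basicOpen_le r)).op r ^ k • b =
        M.presheaf.map (homOfLE (S.basicOpen_le r)).op a) ∧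
    (∀ a : Γ(M, U), M.presheaf.map (homOfLE (S.basicOpen_le r)).op a = 0 →
      ∃ k : ℕ, r ^ k • a = 0) := by
  subst hU
  obtain ⟨f, rfl⟩ : ∃ f : R, (j.appIso ⊤).inv ((Scheme.ΓSpecIso R).inv f) = r :=
    ⟨(Scheme.ΓSpecIso R).hom ((j.appIso ⊤).hom r), by simp⟩
  set r := (j.appIso ⊤).inv ((Scheme.ΓSpecIso R).inv f) with hr
  have hD : j ''ᵁ PrimeSpectrum.basicOpen f = S.basicOpen r := by
    rw [hr, ← Scheme.image_basicOpen, basicOpen_eq_of_affine]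
  have hq : (M.restrict j).IsQuasicoherent := Scheme.Modules.isQuasicoherent_restrictFunctor j M
  generalize S.basicOpen_le r = hle
  generalize S.basicOpen r = D at *
  subst hD
  constructor
  · intro b
    obtain ⟨k, a, h⟩ := spec_surj (M.restrict j) f _ rfl b
    refine ⟨k, a, Eq.trans ?_ h⟩
    change _ = (j.appIso (PrimeSpectrum.basicOpen f)).inv
      ((Spec R).presheaf.map (homOfLE le_top).op ((Scheme.ΓSpecIso R).inv (f ^ k))) • b
    congr 1
    rw [map_pow, map_pow, map_pow, hr]
    congr 1
    have := (j.appIso_inv_naturality (homOfLE (le_top :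
      (PrimeSpectrum.basicOpen f : (Spec R).Opens) ≤ ⊤)).op)
    exact congr($this ((Scheme.ΓSpecIso R).inv f)).symm
  · intro a ha
    obtain ⟨k, h⟩ := spec_inj (M.restrict j) f a ha
    refine ⟨k, Eq.trans ?_ h⟩
    change _ = (j.appIso ⊤).inv
      ((Spec R).presheaf.map (homOfLE le_top).op ((Scheme.ΓSpecIso R).inv (f ^ k))) • a
    congr 1
    rw [map_pow, map_pow, map_pow, hr]
    congr 1

/-- Restriction from an affine open `U` to a basic open `D(f)` localizes the sections of a
quasi-coherent module. -/
theorem localization {S : Scheme.{u}} (M : S.Modules) [M.IsQuasicoherent] {U : S.Opens}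
    (hU : IsAffineOpen U) (f : Γ(S, U)) :
    (∀ b : Γ(M, S.basicOpen f), ∃ (k : ℕ) (a : Γ(M, U)),
      S.presheaf.map (homOfLE (S.basicOpen_le f)).op f ^ k • b =
        M.presheaf.map (homOfLE (S.basicOpen_le f)).op a) ∧
    (∀ a : Γ(M, U), M.presheaf.map (homOfLE (S.basicOpen_le f)).op a = 0 →
      ∃ k : ℕ, f ^ k • a = 0) :=
  aux M hU.fromSpec (by simp) f
end QCoh

namespace GradedQCohAlg
variable {S : Scheme.{u}} (A : GradedQCohAlg S)

theorem mem_part {U : S.Opens} {n : ℕ} {x : A.Sec U} : x ∈ A.part U n ↔ ∃ a, A.of U n a = x :=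
  Iff.rfl

theorem algMap_pow_mul_of {U : S.Opens} (r : Γ(S, U)) {n : ℕ} (x : A.piece U n) (k : ℕ) :
    A.algMap U r ^ k * A.of U n x = A.of U n (r ^ k • x) := by
  rw [← map_pow, algMap_mul_of]

theorem of_injective (U : S.Opens) (n : ℕ) : Function.Injective (A.of U n) :=
  DirectSum.of_injective n

/-- Over an affine open `U`, the algebra of sections over `D(f)` is the localization of the algebra
of sections over `U` at `f`. -/
theorem isAway_res {U : S.Opens} (hU : IsAffineOpen U) (f : Γ(S, U)) :
    GradedLoc.IsAway (A.res (homOfLE (S.basicOpen_le f))) (A.algMap U f) where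
  mem := ⟨_, rfl⟩
  inv := by
    obtain ⟨v, hv⟩ := isUnit_iff_exists_inv.mp (RingedSpace.isUnit_res_basicOpen S.toRingedSpace f)
    refine ⟨A.algMap _ v, ⟨_, rfl⟩, ?_⟩
    rw [res_algMap]
    exact ((A.algMap _).map_mul _ _).symm.trans ((congrArg _ hv).trans (_root_.map_one _))
  surj := by
    rintro n _ ⟨b, rfl⟩
    have := A.isQuasicoherent n
    obtain ⟨k, a, h⟩ := (QCoh.localization (A.deg n) hU f).1 b
    refine ⟨k, A.of U n a, ⟨a, rfl⟩, ?_⟩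
    rw [res_algMap, res_of, algMap_pow_mul_of]
    exact congrArg _ h
  inj := by
    rintro n _ ⟨a, rfl⟩ h
    have := A.isQuasicoherent n
    rw [res_of] at h
    obtain ⟨k, hk⟩ := (QCoh.localization (A.deg n) hU f).2 a
      (A.of_injective _ _ (h.trans (map_zero _).symm))
    exact ⟨k, by rw [algMap_pow_mul_of, hk, map_zero]⟩

end GradedQCohAlg

namespace GradedLoc
variable {A B σ τ : Type u} [CommRing A] [SetLike σ A] [AddSubgroupClass σ A]
  [CommRing B] [SetLike τ B] [AddSubgroupClass τ B]
  {𝒜 : ℕ → σ} {ℬ : ℕ → τ} [GradedRing 𝒜] [GradedRing ℬ]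

theorem proj_hom_ext (g : 𝒜 →+*ᵍ ℬ) (h : ℬ₊ ≤ 𝒜₊.map g) {Z : Scheme.{u}} {a b : Proj ℬ ⟶ Z}
    (H : ∀ (n : ℕ) (hn : 0 < n) (s : A) (hs : s ∈ 𝒜 n),
      Proj.awayι ℬ (g s) (map_mem g hs) hn ≫ a = Proj.awayι ℬ (g s) (map_mem g hs) hn ≫ b) :
    a = b :=
  (Proj.mapAffineOpenCover g h).openCover.hom_ext _ _ fun (j : Σ j : PNat, 𝒜 j) ↦
    H j.1 j.1.2 j.2.1 j.2.2

theorem val_fromZero (P : Submonoid A) (x : 𝒜 0) :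
    (fromZeroRingHom 𝒜 P x).val = Localization.mk (x : A) 1 := rfl

theorem map_fromZero (g : 𝒜 →+*ᵍ ℬ) (s : A) (x : 𝒜 0) (y : ℬ 0) (hxy : g x = y) :
    Away.map g s (fromZeroRingHom 𝒜 _ x) = fromZeroRingHom ℬ _ y := by
  apply HomogeneousLocalization.val_injective
  rw [val_fromZero]
  change Localization.mk (g x) ⟨g 1, _⟩ = _
  rw [Localization.mk_eq_mk_iff, Localization.r_iff_exists]
  exact ⟨1, by simp [hxy]⟩

theorem toSpecZero_preimage (f : 𝒜 0) :
    Proj.toSpecZero 𝒜 ⁻¹ᵁ PrimeSpectrum.basicOpen f = Proj.basicOpen 𝒜 (f : A) := by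
  ext x
  obtain ⟨n, s, hn, hs, hsx⟩ : ∃ (n : ℕ) (s : A), 0 < n ∧ s ∈ 𝒜 n ∧
      s ∉ x.asHomogeneousIdeal := by
    by_contra! H
    exact x.not_irrelevant_le ((HomogeneousIdeal.irrelevant_le _).mpr fun i hi a ha ↦ H i a hi ha)
  have hxs : x ∈ (Proj.awayι 𝒜 s hs hn).opensRange := by
    rw [Proj.opensRange_awayι]
    exact hsx
  obtain ⟨y, rfl⟩ := hxs
  have hfs : (f : A) * s ∈ 𝒜 n := by simpa using SetLike.mul_mem_graded f.2 hs
  have h1 : Proj.awayι 𝒜 s hs hn y ∈ Proj.toSpecZero 𝒜 ⁻¹ᵁ PrimeSpectrum.basicOpen f ↔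
      fromZeroRingHom 𝒜 (.powers s) f ∉ y.asIdeal := by
    have := congr($(Proj.awayι_toSpecZero 𝒜 s hs hn) y)
    change Proj.toSpecZero 𝒜 (Proj.awayι 𝒜 s hs hn y) ∈ PrimeSpectrum.basicOpen f ↔ _
    rw [← Scheme.Hom.comp_apply, this]
    rfl
  have h2 : Proj.awayι 𝒜 s hs hn y ∈ Proj.basicOpen 𝒜 (f : A) ↔
      Away.isLocalizationElem hs hfs ∉ y.asIdeal := by
    have h3 : Proj.awayι 𝒜 s hs hn y ∈ Proj.basicOpen 𝒜 (f : A) ↔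
        Proj.awayι 𝒜 s hs hn y ∈ Proj.basicOpen 𝒜 ((f : A) * s) := by
      rw [Proj.basicOpen_mul]
      exact ⟨fun h ↦ ⟨h, hsx⟩, fun h ↦ h.1⟩
    have h4 := Proj.awayι_preimage_basicOpen 𝒜 hs hn hfs hn
    rw [h3]
    change y ∈ Proj.awayι 𝒜 s hs hn ⁻¹ᵁ Proj.basicOpen 𝒜 ((f : A) * s) ↔ _
    rw [h4]
    rfl
  have h5 : Away.isLocalizationElem hs hfs = fromZeroRingHom 𝒜 (.powers s) f ^ n := by
    apply HomogeneousLocalization.val_injective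
    rw [Away.val_mk, HomogeneousLocalization.val_pow, val_fromZero, Localization.mk_pow]
    rw [Localization.mk_eq_mk_iff, Localization.r_iff_exists]
    exact ⟨1, by simp; ring⟩
  refine h1.trans (Iff.trans ?_ h2.symm)
  rw [h5, y.2.pow_mem_iff_mem n hn]

end GradedLoc

namespace GradedQCohAlg
variable {S : Scheme.{u}} (A : GradedQCohAlg S)

/-- The structure map `𝒪_S(U) → A_0(U)`. -/
def algMapZero (U : S.Opens) : Γ(S, U) →+* A.part U 0 where
  toFun r := ⟨A.algMap U r, ⟨_, rfl⟩⟩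
  map_one' := Subtype.ext ((A.algMap U).map_one)
  map_zero' := Subtype.ext ((A.algMap U).map_zero)
  map_add' r s := Subtype.ext ((A.algMap U).map_add r s)
  map_mul' r s := Subtype.ext ((A.algMap U).map_mul r s)

/-- The structure map `Proj A(U) ⟶ Spec Γ(S, U)`. -/
def projToSpec (U : S.Opens) : Proj (A.part U) ⟶ Spec Γ(S, U) :=
  Proj.toSpecZero (A.part U) ≫ Spec.map (CommRingCat.ofHom (A.algMapZero U))

theorem awayι_projToSpec (U : S.Opens) {n : ℕ} (hn : 0 < n) (s : A.Sec U) (hs : s ∈ A.part U n) :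
    Proj.awayι (A.part U) s hs hn ≫ A.projToSpec U = Spec.map (CommRingCat.ofHom
      ((fromZeroRingHom (A.part U) (.powers s)).comp (A.algMapZero U))) := by
  rw [projToSpec, Proj.awayι_toSpecZero_assoc, ← Spec.map_comp]
  rfl

theorem map_projToSpec {U V : S.Opens} (i : V ⟶ U)
    (h : (A.part V)₊ ≤ (A.part U)₊.map (A.res i)) :
    Proj.map (A.res i) h ≫ A.projToSpec U = A.projToSpec V ≫ Spec.map (S.presheaf.map i.op) := by
  refine GradedLoc.proj_hom_ext (A.res i) h fun n hn s hs ↦ ?_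
  rw [Proj.awayι_comp_map_assoc _ h hn s hs, awayι_projToSpec,
    ← Category.assoc, awayι_projToSpec, ← Spec.map_comp, ← Spec.map_comp]
  congr 1
  exact CommRingCat.hom_ext (RingHom.ext fun r ↦
    GradedLoc.map_fromZero (A.res i) s (A.algMapZero U r)
      (A.algMapZero V (S.presheaf.map i.op r)) (A.res_algMap i r))

theorem projToSpec_preimage_basicOpen (U : S.Opens) (f : Γ(S, U)) :
    A.projToSpec U ⁻¹ᵁ PrimeSpectrum.basicOpen f = Proj.basicOpen (A.part U) (A.algMap U f) :=
  GradedLoc.toSpecZero_preimage (𝒜 := A.part U) (A.algMapZero U f)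

/-- The inclusion underlying a morphism of the affine Zariski site. -/
abbrev incl {V U : S.AffineZariskiSite} (i : V ⟶ U) : V.toOpens ⟶ U.toOpens :=
  (Scheme.AffineZariskiSite.toOpensFunctor S).map i

theorem isAway_res_hom {U V : S.AffineZariskiSite} (i : V ⟶ U) :
    ∃ f, S.basicOpen f = V.toOpens ∧
      GradedLoc.IsAway (A.res (incl i)) (A.algMap U.toOpens f) := by
  obtain ⟨V, hV⟩ := V
  obtain ⟨f, rfl⟩ := leOfHom i
  exact ⟨f, rfl, A.isAway_res U.2 f⟩

theorem res_irrelevant {U V : S.AffineZariskiSite} (i : V ⟶ U) :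
    (A.part V.toOpens)₊ ≤ (A.part U.toOpens)₊.map
      (A.res (incl i)) :=
  (A.isAway_res_hom i).choose_spec.2.irrelevant

theorem projMap_congr {U V : S.Opens} {i j : A.part U →+*ᵍ A.part V} (h : i = j)
    (hi : (A.part V)₊ ≤ (A.part U)₊.map i) (hj : (A.part V)₊ ≤ (A.part U)₊.map j) :
    Proj.map i hi = Proj.map j hj := by
  subst h; rfl

/-- The diagram of the schemes `Proj A(U)`. -/
def projFunctor : S.AffineZariskiSite ⥤ Scheme.{u} where
  obj U := Proj (A.part U.toOpens)
  map {V U} i := Proj.map (A.res (incl i))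
    (A.res_irrelevant i)
  map_id U := (A.projMap_congr (A.res_id _) _ (by simp)).trans Proj.map_id
  map_comp {W V U} j i :=
    (A.projMap_congr (A.res_comp (incl i)
      (incl j)) _ _).trans
      (Proj.map_comp _ _ (A.res_irrelevant i) (A.res_irrelevant j))

/-- The structure maps `Proj A(U) ⟶ Spec Γ(S, U)`. -/
def projNatTransSpec : A.projFunctor ⟶
    Scheme.AffineZariskiSite.toOpensFunctor S ⋙ S.presheaf.rightOp ⋙ Scheme.Spec where
  app U := A.projToSpec U.toOpens
  naturality _ _ i := A.map_projToSpec _ (A.res_irrelevant i)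

/-- The structure maps `Proj A(U) ⟶ U`. -/
def projNatTrans : A.projFunctor ⟶
    Scheme.AffineZariskiSite.toOpensFunctor S ⋙ S.restrictFunctor ⋙ Over.forget _ :=
  A.projNatTransSpec ≫ (Scheme.AffineZariskiSite.restrictIsoSpec S).inv

theorem isPullback_projToSpec {U : S.Opens} (hU : IsAffineOpen U) (f : Γ(S, U))
    (i : S.basicOpen f ⟶ U) (h : GradedLoc.IsAway (A.res i) (A.algMap U f)) :
    IsPullback (Proj.map (A.res i) h.irrelevant) (A.projToSpec (S.basicOpen f))
      (A.projToSpec U) (Spec.map (S.presheaf.map i.op)) := by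
  have h1 := h.isOpenImmersion
  have h2 : IsLocalization.Away f Γ(S, S.basicOpen f) := hU.isLocalization_basicOpen f
  have h3 : IsOpenImmersion (Spec.map (S.presheaf.map i.op)) :=
    IsOpenImmersion.of_isLocalization f
  refine (IsOpenImmersion.isPullback _ _ _ _ (A.map_projToSpec _ h.irrelevant) ?_).flip
  have h4 : (Spec.map (S.presheaf.map i.op)).opensRange = PrimeSpectrum.basicOpen f :=
    TopologicalSpace.Opens.coe_inj.mp (PrimeSpectrum.localization_away_comap_range _ f)
  rw [h4]
  exact (A.projToSpec_preimage_basicOpen _ f).trans h.opensRange.symm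

theorem projNatTransSpec_equifibered : A.projNatTransSpec.Equifibered := by
  intro V U i
  obtain ⟨f, hf, h⟩ := A.isAway_res_hom i
  obtain ⟨V, hV⟩ := V
  change S.basicOpen f = V at hf
  subst hf
  exact A.isPullback_projToSpec U.2 f _ h

theorem projNatTrans_equifibered : A.projNatTrans.Equifibered := by
  have : IsIso (Scheme.AffineZariskiSite.restrictIsoSpec S).inv := Iso.isIso_inv _
  exact A.projNatTransSpec_equifibered.comp (.of_isIso _)

/-- The gluing datum for the relative `Proj`. -/
def gluingData : (Scheme.AffineZariskiSite.directedCover S).RelativeGluingData where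
  functor := A.projFunctor
  natTrans := A.projNatTrans
  equifibered := A.projNatTrans_equifibered

instance : (A.gluingData.functor ⋙ Scheme.forget).IsLocallyDirected :=
  Scheme.Cover.RelativeGluingData.instIsLocallyDirectedI₀CompFunctorForgetOfIsThin ..

/-- The relative homogeneous spectrum `Proj A`, glued from the schemes `Proj (⨁ n, A_n(U))` for
`U` affine open in `S`. -/
def relProj : Scheme.{u} := A.gluingData.glued

/-- The structure morphism of the relative homogeneous spectrum. -/
def relProjToBase : A.relProj ⟶ S := A.gluingData.toBase

/-- The chart `Proj (⨁ n, A_n(U)) ⟶ Proj A`, with image the preimage of `U`. -/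
def chart (U : S.AffineZariskiSite) : Proj (A.part U.toOpens) ⟶ A.relProj :=
  A.gluingData.cover.f U

instance (U : S.AffineZariskiSite) : IsOpenImmersion (A.chart U) :=
  A.gluingData.cover.map_prop U

theorem chart_comp {V U : S.AffineZariskiSite} (i : V ⟶ U) :
    Proj.map (A.res (incl i))
      (A.res_irrelevant i) ≫ A.chart U = A.chart V :=
  Limits.colimit.w A.gluingData.functor i

theorem chart_toBase (U : S.AffineZariskiSite) :
    A.chart U ≫ A.relProjToBase = A.projToSpec U.toOpens ≫ IsAffineOpen.fromSpec U.2 := by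
  refine (A.gluingData.ι_toBase U).trans ?_
  change (A.projToSpec U.toOpens ≫ (IsAffineOpen.isoSpec U.2).inv) ≫ U.toOpens.ι = _
  rw [Category.assoc]
  rfl

theorem preimage_toBase (U : S.AffineZariskiSite) :
    A.relProjToBase ⁻¹ᵁ U.toOpens = (A.chart U).opensRange := by
  simpa using! A.gluingData.toBase_preimage_eq_opensRange_ι U

end GradedQCohAlg

namespace SchemeGlue
variable {Y Z : Scheme.{u}} {ι : Type u} (W : ι → Scheme.{u}) (j : ∀ i, W i ⟶ Y)
  [∀ i, IsOpenImmersion (j i)] (k : ∀ i, W i ⟶ Z)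

/-- The union of the images of a family of open immersions. -/
def union : Y.Opens := ⨆ i, (j i).opensRange

theorem le_union (i : ι) : (j i).opensRange ≤ union W j := le_iSup (fun i ↦ (j i).opensRange) i

/-- The open immersion `W i ⟶ Y`, as a morphism to the union of all images. -/
def toUnion (i : ι) : W i ⟶ (union W j).toScheme :=
  IsOpenImmersion.lift (union W j).ι (j i) (by
    rw [Scheme.Opens.range_ι]
    exact le_union W j i)

theorem toUnion_ι (i : ι) : toUnion W j i ≫ (union W j).ι = j i :=
  IsOpenImmersion.lift_fac _ _ _

instance (i : ι) : IsOpenImmersion (toUnion W j i) := by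
  have : IsOpenImmersion (toUnion W j i ≫ (union W j).ι) := by
    rw [toUnion_ι]; infer_instance
  exact IsOpenImmersion.of_comp _ (union W j).ι

/-- The open cover of the union. -/
def unionCover : (union W j).toScheme.OpenCover where
  I₀ := ι
  X := W
  f := toUnion W j
  mem₀ := by
    rw [Scheme.presieve₀_mem_precoverage_iff]
    refine ⟨fun x ↦ ?_, inferInstance⟩
    obtain ⟨i, y, hy⟩ := TopologicalSpace.Opens.mem_iSup.mp x.2
    refine ⟨i, y, (union W j).ι.injective ?_⟩
    rw [← Scheme.Hom.comp_apply, toUnion_ι]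
    exact hy

/-- A family of morphisms `k i : W i ⟶ Z` is compatible if the morphisms agree on overlaps. -/
def Compatible : Prop :=
  ∀ i₁ i₂ (y : Y), y ∈ (j i₁).opensRange → y ∈ (j i₂).opensRange →
    ∃ (l : ι) (ρ₁ : W l ⟶ W i₁) (ρ₂ : W l ⟶ W i₂), y ∈ (j l).opensRange ∧
      ρ₁ ≫ j i₁ = j l ∧ ρ₂ ≫ j i₂ = j l ∧ ρ₁ ≫ k i₁ = ρ₂ ≫ k i₂

variable {W j k}

theorem Compatible.eq (H : Compatible W j k) (i₁ i₂ : ι) :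
    Limits.pullback.fst (toUnion W j i₁) (toUnion W j i₂) ≫ k i₁ =
      Limits.pullback.snd (toUnion W j i₁) (toUnion W j i₂) ≫ k i₂ := by
  refine Scheme.hom_ext_of_forall _ _ fun x ↦ ?_
  have e1 : ((Limits.pullback.fst (toUnion W j i₁) (toUnion W j i₂) ≫ toUnion W j i₁) ≫
      (union W j).ι) x = j i₁ (Limits.pullback.fst (toUnion W j i₁) (toUnion W j i₂) x) := by
    rw [Category.assoc, toUnion_ι, Scheme.Hom.comp_apply]
  have e2 : ((Limits.pullback.fst (toUnion W j i₁) (toUnion W j i₂) ≫ toUnion W j i₁) ≫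
      (union W j).ι) x = j i₂ (Limits.pullback.snd (toUnion W j i₁) (toUnion W j i₂) x) := by
    rw [Limits.pullback.condition, Category.assoc, toUnion_ι, Scheme.Hom.comp_apply]
  obtain ⟨l, ρ₁, ρ₂, ⟨w, hw⟩, h1, h2, h⟩ := H i₁ i₂ _ ⟨_, e1.symm⟩ ⟨_, e2.symm⟩
  let q : W l ⟶ Limits.pullback (toUnion W j i₁) (toUnion W j i₂) :=
    Limits.pullback.lift ρ₁ ρ₂ (by
      rw [← cancel_mono (union W j).ι, Category.assoc, Category.assoc, toUnion_ι, toUnion_ι,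
        h1, h2])
  have hq : q ≫ (Limits.pullback.fst (toUnion W j i₁) (toUnion W j i₂) ≫ toUnion W j i₁) ≫
      (union W j).ι = j l := by
    rw [← h1, Category.assoc, toUnion_ι, ← Category.assoc, Limits.pullback.lift_fst]
  have hq1 : IsOpenImmersion q := by
    have : IsOpenImmersion (q ≫ (Limits.pullback.fst (toUnion W j i₁) (toUnion W j i₂) ≫
      toUnion W j i₁) ≫ (union W j).ι) := by rw [hq]; infer_instance
    exact IsOpenImmersion.of_comp _ ((Limits.pullback.fst (toUnion W j i₁) (toUnion W j i₂) ≫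
      toUnion W j i₁) ≫ (union W j).ι)
  refine ⟨q.opensRange, ⟨w, ?_⟩, ?_⟩
  · apply ((Limits.pullback.fst (toUnion W j i₁) (toUnion W j i₂) ≫ toUnion W j i₁) ≫
      (union W j).ι).injective
    rw [← hw, ← hq]
    rfl
  · rw [← cancel_epi q.isoOpensRange.hom, Scheme.Hom.isoOpensRange_hom_ι_assoc,
      Scheme.Hom.isoOpensRange_hom_ι_assoc]
    rw [← Category.assoc, ← Category.assoc, Limits.pullback.lift_fst, Limits.pullback.lift_snd, h]

/-- The morphism glued from a compatible family. -/
def Compatible.glue (H : Compatible W j k) : (union W j).toScheme ⟶ Z :=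
  (unionCover W j).glueMorphisms k H.eq

theorem Compatible.toUnion_glue (H : Compatible W j k) (i : ι) : toUnion W j i ≫ H.glue = k i :=
  (unionCover W j).ι_glueMorphisms k H.eq i

end SchemeGlue

namespace GradedLoc
variable {A B C D σ τ σ' τ' : Type u} [CommRing A] [SetLike σ A] [AddSubgroupClass σ A]
  [CommRing B] [SetLike τ B] [AddSubgroupClass τ B]
  [CommRing C] [SetLike σ' C] [AddSubgroupClass σ' C]
  [CommRing D] [SetLike τ' D] [AddSubgroupClass τ' D]
  {𝒜 : ℕ → σ} {ℬ : ℕ → τ} {𝒞 : ℕ → σ'} {𝒟 : ℕ → τ'}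
  [GradedRing 𝒜] [GradedRing ℬ] [GradedRing 𝒞] [GradedRing 𝒟]

/-- The homomorphism `𝒜_(s) → ℬ_(t)` for `t` a multiple of `g s`. -/
def awayHom (g : 𝒜 →+*ᵍ ℬ) {s : A} {t c : B} {m : ℕ} (hc : c ∈ ℬ m) (ht : t = g s * c) :
    Away 𝒜 s →+* Away ℬ t :=
  (awayMap ℬ hc ht).comp (Away.map g s)

theorem val_awayHom_mk (g : 𝒜 →+*ᵍ ℬ) {s : A} {t c : B} {m : ℕ} (hc : c ∈ ℬ m)
    (ht : t = g s * c) {n : ℕ} (hs : s ∈ 𝒜 n) (l : ℕ) (a : A) (ha : a ∈ 𝒜 (l • n)) :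
    (awayHom g hc ht (Away.mk 𝒜 hs l a ha)).val =
      Localization.mk (g a * c ^ l) ⟨t ^ l, (Submonoid.mem_powers_iff _ _).mpr ⟨l, rfl⟩⟩ := by
  rw [awayHom, RingHom.comp_apply, Away.map_mk, awayMap_mk, Away.val_mk]

theorem awayHom_awayι (g : 𝒜 →+*ᵍ ℬ) (h : ℬ₊ ≤ 𝒜₊.map g) {s : A} {t c : B} {m n n' : ℕ}
    (hc : c ∈ ℬ m) (ht : t = g s * c) (hs : s ∈ 𝒜 n) (hn : 0 < n) (ht' : t ∈ ℬ n')
    (hn' : 0 < n') (e : n' = n + m) :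
    Spec.map (CommRingCat.ofHom (awayHom g hc ht)) ≫ Proj.awayι 𝒜 s hs hn =
      Proj.awayι ℬ t ht' hn' ≫ Proj.map g h := by
  subst e
  rw [awayHom, CommRingCat.ofHom_comp, Spec.map_comp, Category.assoc,
    ← Proj.awayι_comp_map g h hn s hs, Proj.SpecMap_awayMap_awayι_assoc]

theorem awayHom_comm (g : 𝒜 →+*ᵍ ℬ) (r : ℬ →+*ᵍ 𝒟) (r' : 𝒜 →+*ᵍ 𝒞) (g' : 𝒞 →+*ᵍ 𝒟)
    (hcomm : ∀ x, r (g x) = g' (r' x)) {s : A} {n : ℕ} (hs : s ∈ 𝒜 n) {c t : C} {m : ℕ}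
    (hc : c ∈ 𝒞 m) (ht : t = r' s * c) (hc' : g' c ∈ 𝒟 m) (ht' : g' t = r (g s) * g' c) :
    (awayHom r hc' ht').comp (Away.map g s) = (Away.map g' t).comp (awayHom r' hc ht) := by
  ext x
  obtain ⟨l, a, ha, rfl⟩ := Away.mk_surjective 𝒜 hs x
  rw [RingHom.comp_apply, RingHom.comp_apply, Away.map_mk, val_awayHom_mk, awayHom,
    RingHom.comp_apply, Away.map_mk, awayMap_mk, Away.map_mk, Away.val_mk]
  congr 1
  rw [map_mul, map_pow, hcomm]

end GradedLoc

namespace GradedQCohAlg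
variable {S : Scheme.{u}}

/-- A morphism of graded `𝒪_S`-algebras. -/
structure Hom (A B : GradedQCohAlg S) where
  hom (n : ℕ) : A.deg n ⟶ B.deg n
  app_one (U : S.Opens) : (hom 0).app U (GradedMonoid.GOne.one (A := A.piece U)) =
    GradedMonoid.GOne.one (A := B.piece U)
  app_mul (U : S.Opens) {m n : ℕ} (a : A.piece U m) (b : A.piece U n) :
    (hom (m + n)).app U (GradedMonoid.GMul.mul (A := A.piece U) a b) =
      GradedMonoid.GMul.mul (A := B.piece U) ((hom m).app U a) ((hom n).app U b)

namespace Hom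
variable {A B : GradedQCohAlg S} (ξ : Hom A B)

/-- The induced graded homomorphism on sections. -/
def onSec (U : S.Opens) : A.part U →+*ᵍ B.part U :=
  ExtGraded.mapHom (fun n ↦ ((ξ.hom n).app U).hom) (ξ.app_one U) (ξ.app_mul U)

theorem onSec_of (U : S.Opens) {n : ℕ} (a : A.piece U n) :
    ξ.onSec U (A.of U n a) = B.of U n ((ξ.hom n).app U a) :=
  ExtGraded.mapHom_of _ _ _ _

theorem res_onSec {U V : S.Opens} (i : V ⟶ U) (x : A.Sec U) :
    B.res i (ξ.onSec U x) = ξ.onSec V (A.res i x) := by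
  have : (B.res i).comp (ξ.onSec U) = (ξ.onSec V).comp (A.res i) := by
    refine ExtGraded.hom_ext fun n a ↦ ?_
    change B.res i (ξ.onSec U (A.of U n a)) = ξ.onSec V (A.res i (A.of U n a))
    rw [onSec_of, res_of, res_of, onSec_of]
    exact congrArg _ congr($((ξ.hom n).mapPresheaf.naturality i.op) a).symm
  exact congr($this x)

/-- A homogeneous section of positive degree over an affine open. -/
structure Index (A : GradedQCohAlg S) where
  U : S.AffineZariskiSite
  n : ℕ
  pos : 0 < n
  a : A.Sec U.toOpens
  mem : a ∈ A.part U.toOpens n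

/-- The spectrum of the degree zero localization `B(U)_(ξ a)`. -/
abbrev pieceDom (i : Index A) : Scheme.{u} :=
  Spec (.of (Away (B.part i.U.toOpens) (ξ.onSec i.U.toOpens i.a)))

/-- `D₊(ξ a)` as an open subscheme of the relative `Proj`. -/
def pieceι (i : Index A) : ξ.pieceDom i ⟶ B.relProj :=
  Proj.awayι (B.part i.U.toOpens) (ξ.onSec i.U.toOpens i.a) (map_mem _ i.mem) i.pos ≫ B.chart i.U

instance (i : Index A) : IsOpenImmersion (ξ.pieceι i) :=
  inferInstanceAs (IsOpenImmersion (Proj.awayι _ _ _ _ ≫ B.chart i.U))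

/-- The morphism `D₊(ξ a) ⟶ D₊(a)`. -/
def pieceMap (i : Index A) : ξ.pieceDom i ⟶ A.relProj :=
  Spec.map (CommRingCat.ofHom (Away.map (ξ.onSec i.U.toOpens) i.a)) ≫
    Proj.awayι (A.part i.U.toOpens) i.a i.mem i.pos ≫ A.chart i.U

theorem refine_piece (i : Index A) {V : S.AffineZariskiSite} (r : V ⟶ i.U) {m : ℕ}
    (c t : A.Sec V.toOpens) (hc : c ∈ A.part V.toOpens m)
    (ht : t = A.res (incl r) i.a * c)
    {n' : ℕ} (hn' : 0 < n') (ht' : t ∈ A.part V.toOpens n') (e : n' = i.n + m) :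
    ∃ ρ : ξ.pieceDom ⟨V, n', hn', t, ht'⟩ ⟶ ξ.pieceDom i,
      ρ ≫ ξ.pieceι i = ξ.pieceι ⟨V, n', hn', t, ht'⟩ ∧
      ρ ≫ ξ.pieceMap i = ξ.pieceMap ⟨V, n', hn', t, ht'⟩ := by
  have h1 : ξ.onSec V.toOpens t = B.res (incl r)
      (ξ.onSec i.U.toOpens i.a) * ξ.onSec V.toOpens c := by
    rw [ht, map_mul, res_onSec]
  refine ⟨Spec.map (CommRingCat.ofHom (GradedLoc.awayHom
    (B.res (incl r)) (map_mem _ hc) h1)), ?_, ?_⟩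
  · dsimp only [pieceι]
    rw [← Category.assoc, GradedLoc.awayHom_awayι _ (B.res_irrelevant r) _ _ (map_mem _ i.mem)
      i.pos (map_mem _ ht') hn' e, Category.assoc, B.chart_comp]
  · dsimp only [pieceMap]
    rw [← Category.assoc, ← Spec.map_comp, ← CommRingCat.ofHom_comp,
      GradedLoc.awayHom_comm (ξ.onSec i.U.toOpens) _
        (A.res (incl r)) (ξ.onSec V.toOpens)
        (ξ.res_onSec _) i.mem hc ht, CommRingCat.ofHom_comp, Spec.map_comp, Category.assoc,
      ← Category.assoc (Spec.map (CommRingCat.ofHom (GradedLoc.awayHom _ hc ht))),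
      GradedLoc.awayHom_awayι _ (A.res_irrelevant r) hc ht i.mem i.pos ht' hn' e, Category.assoc,
      A.chart_comp]

theorem mem_pieceι_res (i : Index A) {V : S.AffineZariskiSite} (r : V ⟶ i.U)
    (z : Proj (B.part V.toOpens)) (h : B.chart V z ∈ (ξ.pieceι i).opensRange) :
    z ∈ Proj.basicOpen (B.part V.toOpens) (ξ.onSec V.toOpens
      (A.res (incl r) i.a)) := by
  obtain ⟨w, hw⟩ := h
  rw [← B.chart_comp r, Scheme.Hom.comp_apply] at hw
  have hw' : Proj.awayι (B.part i.U.toOpens) (ξ.onSec i.U.toOpens i.a) (map_mem _ i.mem) i.pos w =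
    Proj.map (B.res (incl r)) (B.res_irrelevant r) z := (B.chart i.U).injective hw
  have h1 : Proj.awayι (B.part i.U.toOpens) (ξ.onSec i.U.toOpens i.a) (map_mem _ i.mem) i.pos w ∈
      Proj.basicOpen (B.part i.U.toOpens) (ξ.onSec i.U.toOpens i.a) := by
    rw [← Proj.opensRange_awayι _ _ (map_mem _ i.mem) i.pos]
    exact ⟨w, rfl⟩
  rw [hw'] at h1
  rw [← res_onSec]
  exact h1

theorem compatible : SchemeGlue.Compatible ξ.pieceDom ξ.pieceι ξ.pieceMap := by
  intro i₁ i₂ y h1 h2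
  have hy1 : B.relProjToBase y ∈ i₁.U.toOpens := by
    obtain ⟨w, rfl⟩ := h1
    exact (B.preimage_toBase i₁.U).ge ⟨Proj.awayι _ _ _ _ w, rfl⟩
  have hy2 : B.relProjToBase y ∈ i₂.U.toOpens := by
    obtain ⟨w, rfl⟩ := h2
    exact (B.preimage_toBase i₂.U).ge ⟨Proj.awayι _ _ _ _ w, rfl⟩
  obtain ⟨f, g, e, hx⟩ := exists_basicOpen_le_affine_inter i₁.U.2 i₂.U.2 _ ⟨hy1, hy2⟩
  let V : S.AffineZariskiSite := i₁.U.basicOpen f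
  let r₁ : V ⟶ i₁.U := homOfLE (i₁.U.basicOpen_le f)
  let r₂ : V ⟶ i₂.U := homOfLE ⟨g, e.symm⟩
  obtain ⟨z, rfl⟩ : y ∈ (B.chart V).opensRange := (B.preimage_toBase V).le hx
  have m1 := map_mem (A.res (incl r₁)) i₁.mem
  have m2 := map_mem (A.res (incl r₂)) i₂.mem
  have mt := SetLike.mul_mem_graded m1 m2
  have hn := Nat.add_pos_left i₁.pos i₂.n
  obtain ⟨ρ₁, h11, h12⟩ := ξ.refine_piece i₁ r₁ _ _ m2 rfl hn mt rfl
  obtain ⟨ρ₂, h21, h22⟩ := ξ.refine_piece i₂ r₂ _ _ m1 (mul_comm _ _) hn mt (add_comm _ _)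
  refine ⟨_, ρ₁, ρ₂, ?_, h11, h21, h12.trans h22.symm⟩
  have hz : z ∈ Proj.basicOpen (B.part V.toOpens) (ξ.onSec V.toOpens
      (A.res (incl r₁) i₁.a * A.res (incl r₂) i₂.a)) := by
    rw [map_mul, Proj.basicOpen_mul]
    exact ⟨ξ.mem_pieceι_res i₁ r₁ z h1, ξ.mem_pieceι_res i₂ r₂ z h2⟩
  rw [← Proj.opensRange_awayι _ _ (map_mem (ξ.onSec V.toOpens) mt) hn] at hz
  obtain ⟨w, rfl⟩ := hz
  exact ⟨w, rfl⟩

/-- The open subset `G(ξ)` of `Proj B`: the union over all affine open `U` of `S` and all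
homogeneous `a ∈ A(U)` of positive degree of the sets `D₊(ξ a)`, i.e. the complement of
`V₊(ξ(A₊))`. -/
def domain : B.relProj.Opens := SchemeGlue.union ξ.pieceDom ξ.pieceι

/-- The morphism `P(ξ) : G(ξ) ⟶ Proj A`, given on `D₊(ξ a)` by the homomorphism
`A(U)_(a) → B(U)_(ξ a)` induced by `ξ`. -/
def relProjMap : ξ.domain.toScheme ⟶ A.relProj := ξ.compatible.glue

end Hom
end GradedQCohAlg

namespace LinePower
open MonoidalCategory TensorProduct

section Monoidal
variable {C : Type*} [Category* C] [MonoidalCategory C] (L : C)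

/-- The tensor powers `L^{⊗ n}` of an object of a monoidal category. -/
def power : ℕ → C
  | 0 => 𝟙_ C
  | n + 1 => power n ⊗ L

/-- The multiplication `L^{⊗ n} ⊗ L^{⊗ m} ⟶ L^{⊗ (n + m)}`. -/
def powerMul (n : ℕ) : ∀ m : ℕ, power L n ⊗ power L m ⟶ power L (n + m)
  | 0 => (ρ_ (power L n)).hom
  | m + 1 => (α_ (power L n) (power L m) L).inv ≫ powerMul n m ▷ L

/-- The isomorphism `L^{⊗ 1} ≅ L`. -/
def powerOne : power L 1 ≅ L := λ_ L

end Monoidal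

variable {X : Scheme.{u}} (L : X.Modules)

/-- The underlying presheaf of modules of an `𝒪_X`-module. -/
def toPre : PresheafOfModules.{u} (X.presheaf ⋙ forget₂ CommRingCat RingCat) := L.val

/-- The presheaf `U ↦ L(U)^{⊗ n}`. -/
def pre (n : ℕ) : PresheafOfModules.{u} (X.presheaf ⋙ forget₂ CommRingCat RingCat) :=
  power (toPre L) n

/-- The sections `L(U)^{⊗ n}` of the presheaf tensor power. -/
abbrev PreSec (n : ℕ) (U : X.Opens) : Type u := (pre L n).obj (.op U)

/-- The sheafification of a presheaf of modules. -/
def sheafify (P : PresheafOfModules.{u} (X.presheaf ⋙ forget₂ CommRingCat RingCat)) : X.Modules :=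
  (PresheafOfModules.sheafification (𝟙 X.ringCatSheaf.obj)).obj P

/-- The tensor power `L^{⊗ n}` as an `𝒪_X`-module: the sheaf associated with
`U ↦ L(U)^{⊗ n}`. -/
def pow (n : ℕ) : X.Modules := sheafify (pre L n)

/-- The canonical map from the sections of the presheaf tensor power to those of `L^{⊗ n}`. -/
def mk (n : ℕ) (U : X.Opens) (x : PreSec L n U) : Γ(pow L n, U) :=
  ((PresheafOfModules.sheafificationAdjunction (𝟙 X.ringCatSheaf.obj)).unit.app
    (pre L n)).app (.op U) x

/-- The isomorphism `L^{⊗ 1} ≅ L`. -/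
def powOne : pow L 1 ≅ L :=
  (PresheafOfModules.sheafification (𝟙 X.ringCatSheaf.obj)).mapIso (powerOne (toPre L)) ≪≫
    (asIso (PresheafOfModules.sheafificationAdjunction (𝟙 X.ringCatSheaf.obj)).counit).app L

/-- The product `L(U)^{⊗ n} × L(U)^{⊗ m} → L(U)^{⊗ (n + m)}`. -/
def preMul {n m : ℕ} {U : X.Opens} (x : PreSec L n U) (y : PreSec L m U) : PreSec L (n + m) U :=
  (powerMul (toPre L) n m).app (.op U) (x ⊗ₜ[Γ(X, U)] y)

/-- The unit section of `L^{⊗ 0} = 𝒪_X`. -/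
def preOne (U : X.Opens) : PreSec L 0 U := (1 : Γ(X, U))

/-- The power `l ⊗ ⋯ ⊗ l` of a section. -/
def prePow {U : X.Opens} (l : Γ(L, U)) : ∀ n : ℕ, PreSec L n U
  | 0 => preOne L U
  | n + 1 => (prePow l n) ⊗ₜ[Γ(X, U)] (show (toPre L).obj (.op U) from l)

variable {L} in
/-- The section `e` generates `L` freely over `U`: multiplication by `e` is an isomorphism
`𝒪_X ⟶ L` over `U`. -/
def IsGenerator {U : X.Opens} (e : Γ(L, U)) : Prop :=
  ∀ (V : X.Opens) (i : V ⟶ U), Function.Bijective fun r : Γ(X, V) ↦ r • L.presheaf.map i.op e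

/-- Invertible `𝒪_X`-modules: locally free of rank one. -/
def IsInvertible : Prop :=
  ∀ x : X, ∃ (U : X.Opens) (_ : x ∈ U) (e : Γ(L, U)), IsGenerator e

end LinePower

namespace GradedQCohAlg
variable {S X : Scheme.{u}}

/-- The restriction to `W ⊆ f⁻¹(U)` of the pulled back section `f^* a` of `f^* M`. -/
def pull (f : X ⟶ S) (M : S.Modules) {U : S.Opens} (a : Γ(M, U)) {W : X.Opens}
    (h : W ≤ f ⁻¹ᵁ U) : Γ((Scheme.Modules.pullback f).obj M, W) :=
  ((Scheme.Modules.pullback f).obj M).presheaf.map (homOfLE h).op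
    (((Scheme.Modules.pullbackPushforwardAdjunction f).unit.app M).app U a)

/-- A homomorphism of graded `𝒪_X`-algebras `ψ : f^* A ⟶ ⨁ n, L^{⊗ n}`, given by its homogeneous
components `f^* A_n ⟶ L^{⊗ n}`. Since the sections of `f^* A_n` are locally generated over `𝒪_X` by
pulled back sections, and the sections of `L^{⊗ n}` are locally sections of the presheaf tensor
power, the conditions that `ψ` preserves the unit and products are tested on those. -/
structure PowerHom (f : X ⟶ S) (A : GradedQCohAlg S) (L : X.Modules) where
  hom (n : ℕ) : (Scheme.Modules.pullback f).obj (A.deg n) ⟶ LinePower.pow L n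
  app_one {U : S.Opens} {W : X.Opens} (h : W ≤ f ⁻¹ᵁ U) :
    (hom 0).app W (pull f (A.deg 0) (GradedMonoid.GOne.one (A := A.piece U)) h) =
      LinePower.mk L 0 W (LinePower.preOne L W)
  app_mul {U : S.Opens} {W : X.Opens} (h : W ≤ f ⁻¹ᵁ U) {m n : ℕ} (a : A.piece U m)
    (b : A.piece U n) (x : LinePower.PreSec L m W) (y : LinePower.PreSec L n W)
    (hx : (hom m).app W (pull f (A.deg m) a h) = LinePower.mk L m W x)
    (hy : (hom n).app W (pull f (A.deg n) b h) = LinePower.mk L n W y) :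
    (hom (m + n)).app W (pull f (A.deg (m + n)) (GradedMonoid.GMul.mul (A := A.piece U) a b) h) =
      LinePower.mk L (m + n) W (LinePower.preMul L x y)

namespace PowerHom
variable {f : X ⟶ S} {A : GradedQCohAlg S} {L : X.Modules} (ψ : PowerHom f A L)

/-- The degree one part `(f^* A)₁ ⟶ L`. -/
def degOne : (Scheme.Modules.pullback f).obj (A.deg 1) ⟶ L :=
  ψ.hom 1 ≫ (LinePower.powOne L).hom

/-- The section `ψ(f^* a)` of `L` over `W`, for `a` of degree one. -/
def onDegOne {U : S.Opens} {W : X.Opens} (h : W ≤ f ⁻¹ᵁ U) (a : A.piece U 1) : Γ(L, W) :=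
  ψ.degOne.app W (pull f (A.deg 1) a h)

/-- The morphism `φ : X ⟶ Proj A` is the one induced by the pair `(L, ψ)`, i.e. the composite
`X = Proj (⨁ n, L^{⊗ n}) ⟶ Proj (f^* A) ⟶ Proj A`. Explicitly, let `U ⊆ S` be an affine open,
`a ∈ A_1(U)`, and `W ⊆ f⁻¹(U)` an open set on which `l = ψ(f^* a)` generates `L`. On `W`, the
morphism `φ` factors through `D₊(a) = Spec A(U)_(a)` and is given there by the ring homomorphism
`A(U)_(a) → Γ(X, W)` that sends `b / a ^ n` to the function `ψ(f^* b) / l ^ n`. If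
`(f^* A)_1 ⟶ L` is surjective, such `W` cover `X`. -/
def Induces (φ : X ⟶ A.relProj) : Prop :=
  ∀ (U : S.AffineZariskiSite) (a : A.piece U.toOpens 1) (W : X.Opens) (h : W ≤ f ⁻¹ᵁ U.toOpens),
    LinePower.IsGenerator (ψ.onDegOne h a) →
    ∃ g : Away (A.part U.toOpens) (A.of U.toOpens 1 a) →+* Γ(X, W),
      (∀ (n : ℕ) (b : A.piece U.toOpens n),
        g (Away.mk (A.part U.toOpens) (ExtGraded.of_mem a) n (A.of U.toOpens n b)
            (by simpa using ExtGraded.of_mem b)) •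
          LinePower.mk L n W (LinePower.prePow L (ψ.onDegOne h a) n) =
            (ψ.hom n).app W (pull f (A.deg n) b h)) ∧
      W.ι ≫ φ = W.toSpecΓ ≫ Spec.map (CommRingCat.ofHom g) ≫
        Proj.awayι (A.part U.toOpens) (A.of U.toOpens 1 a) (ExtGraded.of_mem a) one_pos ≫
          A.chart U
end PowerHom

/-- Degree zero part `𝒪_S`, degree one part coherent (on a noetherian scheme: quasi-coherent and
of finite type), and locally generated by the degree one part as an `𝒪_S`-algebra. -/
structure IsStandardGraded (A : GradedQCohAlg S) : Prop where
  bijective_zero (U : S.Opens) : Function.Bijective fun r : Γ(S, U) ↦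
    r • (GradedMonoid.GOne.one : A.piece U 0)
  isFiniteType_one : (A.deg 1).IsFiniteType
  generated (U : S.Opens) (n : ℕ) (a : A.piece U n) (x : S) (hx : x ∈ U) :
    ∃ (V : S.Opens) (_ : x ∈ V) (i : V ⟶ U), A.res i (A.of U n a) ∈
      Subring.closure (Set.range (A.algMap V) ∪ Set.range (A.of V 1))

end GradedQCohAlg

end

/-! Write `α` for the degree one part of `ψ₂` and `β` for `ψ₁ ∘ f^*ξ` in degree one. Both conditions
say that the ratios `ψ₂(a)/ψ₂(c)` and `ψ₁(ξa)/ψ₁(ξc)` are the same functions. As `X` is integral,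
with generic point `η`, it is enough to compare them on an open neighbourhood of `η`.

From morphisms to `s`: if `β = 0`, take `s = 0`. Otherwise some `ψ₁(ξc)` generates `L₁` near `η`, so
`φ₁(η)` lies in `D₊(ξc)`; the equality of morphisms then puts `φ₂(η)` in `D₊(c)`, which forces
`ψ₂(c)` to generate `L₂` near `η`. On a neighbourhood `W` of `η` where both generate, the equality
says that `ξ` carries one ring homomorphism to the other, i.e. the ratios agree. So `β` and `α`
become equal after division by `ψ₁(ξc)` and `ψ₂(c)`, as maps to `j_* 𝒪_W`. Division is injective on
`L₁`, since an invertible module on an integral scheme is torsion free. Hence `β` kills `ker α` and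
factors through the epimorphism `α` (`exists_common_generator`, `exists_ratio`, `exists_desc`).

From `s` to morphisms: if `φ₁(η)` is not in `G(ξ)`, then `φ₁⁻¹(G(ξ))` is empty. Otherwise, `A₂`
being generated in degree one, `φ₁(η)` lies in some `D₊(ξb)` with `b` of degree one. Near `η` the
section `ψ₁(ξb) = s(ψ₂(b))` generates `L₁`, so `ψ₂(b) ≠ 0`, and `ψ₂(b)` generates `L₂` on a smaller
neighbourhood of `η`. There `s` gives the equality of ratios in degree one, and generation in degree
one extends it to all fractions `d/b^n`. The two `S`-morphisms agree on a dense open subset of a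
reduced scheme, and `Proj A₂` is separated over `S`, so they are equal (`ringHom_eq`, `eq_of_hom`).
-/

noncomputable section

open HomogeneousLocalization Graded HomogeneousIdeal
open scoped DirectSum

/-! ### Sections of `𝒪_X`-modules and their restrictions. -/

namespace SheafSections
variable {X : Scheme.{u}} (M : X.Modules)

theorem map_map {U V W : X.Opens} (i : V ⟶ U) (j : W ⟶ V) (k : W ⟶ U) (m : Γ(M, U)) :
    M.presheaf.map j.op (M.presheaf.map i.op m) = M.presheaf.map k.op m := by
  rw [Subsingleton.elim k (j ≫ i), op_comp, Functor.map_comp]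
  rfl

theorem eq_of_locally_eq {U : X.Opens} (s t : Γ(M, U))
    (h : ∀ x ∈ U, ∃ (V : X.Opens) (i : V ⟶ U), x ∈ V ∧
      M.presheaf.map i.op s = M.presheaf.map i.op t) : s = t := by
  choose V i hV hst using h
  refine TopCat.Sheaf.eq_of_locally_eq' ⟨M.presheaf, M.isSheaf⟩ (fun x : U ↦ V x.1 x.2) U
    (fun x ↦ i x.1 x.2) (fun x hx ↦ ?_) s t fun x ↦ hst x.1 x.2
  exact TopologicalSpace.Opens.mem_iSup.mpr ⟨⟨x, hx⟩, hV x hx⟩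

theorem app_map {M N : X.Modules} (α : M ⟶ N) {U V : X.Opens} (i : V ⟶ U) (m : Γ(M, U)) :
    α.app V (M.presheaf.map i.op m) = N.presheaf.map i.op (α.app U m) :=
  congr($(α.mapPresheaf.naturality i.op) m)

end SheafSections

/-! ### Generators of invertible modules on an integral scheme. -/

namespace LinePower
open SheafSections
variable {X : Scheme.{u}} {L : X.Modules}

theorem IsGenerator.map {U V : X.Opens} {e : Γ(L, U)} (he : IsGenerator e) (i : V ⟶ U) :
    IsGenerator (L.presheaf.map i.op e) := by
  intro W j
  simp only [map_map L i j (j ≫ i)]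
  exact he W (j ≫ i)

theorem IsGenerator.bijective {U : X.Opens} {e : Γ(L, U)} (he : IsGenerator e) :
    Function.Bijective fun r : Γ(X, U) ↦ r • e := by
  simpa using he U (𝟙 U)

theorem IsGenerator.smul {U : X.Opens} {e : Γ(L, U)} (he : IsGenerator e) {r : Γ(X, U)}
    (hr : IsUnit r) : IsGenerator (r • e) := by
  intro V i
  have hu : IsUnit (X.presheaf.map i.op r) := hr.map (X.presheaf.map i.op).hom
  have : (fun t : Γ(X, V) ↦ t • L.presheaf.map i.op (r • e)) =
      (fun t ↦ t • L.presheaf.map i.op e) ∘ (· * X.presheaf.map i.op r) := by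
    ext t
    simp [mul_smul]
  rw [this]
  exact (he V i).comp (IsUnit.isUnit_iff_mulRight_bijective.mp hu)

theorem inf_nonempty [IrreducibleSpace X] {U V : X.Opens} (hU : (U : Set X).Nonempty)
    (hV : (V : Set X).Nonempty) : ((U ⊓ V : X.Opens) : Set X).Nonempty :=
  nonempty_preirreducible_inter U.2 V.2 hU hV

theorem exists_generator_inf (hL : IsInvertible L) {U : X.Opens} (x : X) (hx : x ∈ U) :
    ∃ (V : X.Opens) (_ : V ⟶ U) (e : Γ(L, V)), x ∈ V ∧ IsGenerator e := by
  obtain ⟨V, hxV, e, he⟩ := hL x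
  exact ⟨U ⊓ V, homOfLE inf_le_left, _, ⟨hx, hxV⟩, he.map (homOfLE inf_le_right)⟩

/-- Torsion freeness. Locally the section is `r • e` with `e` a generator; if it vanishes on the
nonempty overlap with `V`, so does `r`, and functions on an integral scheme restrict injectively to
nonempty open sets. -/
theorem map_injective [IsIntegral X] (hL : IsInvertible L) {U V : X.Opens} (i : V ⟶ U)
    (hV : (V : Set X).Nonempty) : Function.Injective (L.presheaf.map i.op) := by
  refine (injective_iff_map_eq_zero (L.presheaf.map i.op).hom).mpr fun m hm ↦ ?_
  refine eq_of_locally_eq L _ _ fun x hx ↦ ?_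
  obtain ⟨W, j, e, hxW, he⟩ := exists_generator_inf hL x hx
  refine ⟨W, j, hxW, ?_⟩
  obtain ⟨r, hr⟩ := he.bijective.2 (L.presheaf.map j.op m)
  have hne : Nonempty (W ⊓ V : X.Opens) := (inf_nonempty ⟨x, hxW⟩ hV).to_subtype
  let a : W ⊓ V ⟶ W := homOfLE inf_le_left
  have h1 : X.presheaf.map a.op r • L.presheaf.map a.op e = 0 := by
    rw [← Scheme.Modules.map_smul]
    change L.presheaf.map a.op ((fun r : Γ(X, W) ↦ r • e) r) = 0
    rw [hr, map_map L j a (a ≫ j), ← map_map L i (homOfLE inf_le_right) (a ≫ j)]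
    exact (congrArg _ hm).trans (map_zero _)
  have h2 : X.presheaf.map a.op r = 0 := (he _ a).1 (h1.trans (zero_smul _ _).symm)
  have h3 : r = 0 := map_injective_of_isIntegral X a (h2.trans (map_zero _).symm)
  rw [← hr, h3, map_zero]
  exact zero_smul _ _

/-- A nonzero section of an invertible module on an integral scheme is a generator over some
nonempty open set. -/
theorem exists_isGenerator_map [IsIntegral X] (hL : IsInvertible L) {U : X.Opens} (m : Γ(L, U))
    (hm : m ≠ 0) : ∃ (W : X.Opens) (i : W ⟶ U), (W : Set X).Nonempty ∧
      IsGenerator (L.presheaf.map i.op m) := by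
  obtain ⟨x, hx⟩ : ∃ x, x ∈ U := by
    by_contra! h
    exact hm (eq_of_locally_eq L _ _ fun x hx ↦ (h x hx).elim)
  obtain ⟨V, j, e, hxV, he⟩ := exists_generator_inf hL x hx
  obtain ⟨r, hr⟩ := he.bijective.2 (L.presheaf.map j.op m)
  have hr0 : r ≠ 0 := by
    rintro rfl
    refine hm (map_injective hL j ⟨x, hxV⟩ ?_)
    rw [← hr, map_zero]
    exact zero_smul _ _
  -- Where the coefficient `r` is invertible, `r • e` is again a generator; this locus is nonempty
  -- because `r ≠ 0` and `X` is reduced.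
  let k : X.basicOpen r ⟶ V := homOfLE (X.basicOpen_le r)
  refine ⟨X.basicOpen r, k ≫ j, ?_, ?_⟩
  · rw [Set.nonempty_iff_ne_empty]
    intro h
    exact hr0 ((AlgebraicGeometry.basicOpen_eq_bot_iff r).mp (TopologicalSpace.Opens.ext h))
  · rw [← map_map L j k, ← hr, Scheme.Modules.map_smul]
    exact (he.map k).smul (RingedSpace.isUnit_res_basicOpen X.toRingedSpace r)

end LinePower

/-! ### Pulled back sections. -/

namespace GradedQCohAlg
variable {S X : Scheme.{u}} (f : X ⟶ S)
open SheafSections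

/-- The pulled back section `f^* a` of `f^* M` over `f⁻¹(U)`. -/
def pullUnit (M : S.Modules) (U : S.Opens) :
    Γ(M, U) →+ Γ((Scheme.Modules.pullback f).obj M, f ⁻¹ᵁ U) :=
  (((Scheme.Modules.pullbackPushforwardAdjunction f).unit.app M).app U).hom

theorem pull_eq (M : S.Modules) {U : S.Opens} {W : X.Opens} (h : W ≤ f ⁻¹ᵁ U) (a : Γ(M, U)) :
    pull f M a h = ((Scheme.Modules.pullback f).obj M).presheaf.map (homOfLE h).op
      (pullUnit f M U a) := rfl

theorem pullUnit_map (M : S.Modules) {U U' : S.Opens} (i : U' ⟶ U) (a : Γ(M, U)) :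
    pullUnit f M U' (M.presheaf.map i.op a) =
      ((Scheme.Modules.pullback f).obj M).presheaf.map
        ((TopologicalSpace.Opens.map f.base).map i).op (pullUnit f M U a) :=
  app_map ((Scheme.Modules.pullbackPushforwardAdjunction f).unit.app M) i a

theorem app_pullUnit {M N : S.Modules} (α : M ⟶ N) (U : S.Opens) (a : Γ(M, U)) :
    ((Scheme.Modules.pullback f).map α).app (f ⁻¹ᵁ U) (pullUnit f M U a) =
      pullUnit f N U (α.app U a) :=
  congr(($((Scheme.Modules.pullbackPushforwardAdjunction f).unit.naturality α)).app U a).symm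

theorem pull_map (M : S.Modules) {U U' : S.Opens} (i : U' ⟶ U) {W W' : X.Opens}
    (j : W' ⟶ W) (h : W ≤ f ⁻¹ᵁ U) (h' : W' ≤ f ⁻¹ᵁ U') (a : Γ(M, U)) :
    pull f M (M.presheaf.map i.op a) h' =
      ((Scheme.Modules.pullback f).obj M).presheaf.map j.op (pull f M a h) := by
  rw [pull_eq, pull_eq, pullUnit_map, map_map _ (homOfLE h) j (j ≫ homOfLE h)]
  exact map_map _ _ _ _ _

theorem app_pull {M N : S.Modules} (α : M ⟶ N) {U : S.Opens} {W : X.Opens} (h : W ≤ f ⁻¹ᵁ U)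
    (a : Γ(M, U)) : ((Scheme.Modules.pullback f).map α).app W (pull f M a h) =
      pull f N (α.app U a) h := by
  rw [pull_eq, pull_eq, app_map, app_pullUnit]

/-- Morphisms from the pullback `f^* M` agree if they agree on pulled back sections. -/
theorem pullback_hom_ext {M : S.Modules} {N : X.Modules}
    {α β : (Scheme.Modules.pullback f).obj M ⟶ N}
    (h : ∀ (U : S.Opens) (a : Γ(M, U)),
      α.app _ (pull f M a le_rfl) = β.app (f ⁻¹ᵁ U) (pull f M a le_rfl)) : α = β := by
  -- Under the adjunction the two morphisms become maps `M ⟶ f_* N`, whose values on `a` are the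
  -- values of `α` and `β` on the pullback of `a`.
  apply ((Scheme.Modules.pullbackPushforwardAdjunction f).homEquiv _ _).injective
  ext U a
  have := h U a
  simp only [pull_eq, homOfLE_refl, op_id, CategoryTheory.Functor.map_id] at this
  rw [Adjunction.homEquiv_unit, Adjunction.homEquiv_unit]
  exact this

end GradedQCohAlg

/-! ### Division by a generator, and factoring through an epimorphism. -/

namespace LinePower
open SheafSections
variable {X : Scheme.{u}} {L : X.Modules}

/-- The map `powOne` is adjoint to the left unitor of presheaves, so on sections coming from the
presheaf it is the unitor itself, and `1 ⊗ e` goes to `1 • e`. -/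
theorem powOne_mk_prePow {U : X.Opens} (e : Γ(L, U)) :
    (powOne L).hom.app U (mk L 1 U (prePow L e 1)) = e := by
  let adj := PresheafOfModules.sheafificationAdjunction (𝟙 X.ringCatSheaf.obj)
  have h := adj.unit_comp_map_eq_iff (powOne L).hom (powerOne (toPre L)).hom
  have h2 := congr(($(h.mpr (by
    change (PresheafOfModules.sheafification (𝟙 X.ringCatSheaf.obj)).map
      (powerOne (toPre L)).hom ≫ _ = _
    rfl))).app (.op U) (prePow L e 1))
  refine h2.trans ?_
  change (1 : Γ(X, U)) • e = e
  exact one_smul _ _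

/-- The quotient by a generator `e` over `W`, as a function on sections. -/
def divGenerator {W : X.Opens} {e : Γ(L, W)} (he : IsGenerator e) (V : X.Opens) (i : V ⟶ W) :
    Γ(L, V) →ₗ[Γ(X, V)] Γ(X, V) :=
  (LinearEquiv.ofBijective (LinearMap.toSpanSingleton Γ(X, V) Γ(L, V) (L.presheaf.map i.op e))
    (he V i)).symm.toLinearMap

theorem divGenerator_smul {W : X.Opens} {e : Γ(L, W)} (he : IsGenerator e) (V : X.Opens)
    (i : V ⟶ W) (m : Γ(L, V)) : divGenerator he V i m • L.presheaf.map i.op e = m :=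
  (LinearEquiv.ofBijective (LinearMap.toSpanSingleton Γ(X, V) Γ(L, V) (L.presheaf.map i.op e))
    (he V i)).apply_symm_apply m

theorem divGenerator_eq {W : X.Opens} {e : Γ(L, W)} (he : IsGenerator e) {V : X.Opens}
    {i : V ⟶ W} {m : Γ(L, V)} {r : Γ(X, V)} (h : r • L.presheaf.map i.op e = m) :
    divGenerator he V i m = r :=
  (he V i).1 ((divGenerator_smul he V i m).trans h.symm)

theorem divGenerator_map {W : X.Opens} {e : Γ(L, W)} (he : IsGenerator e) {V V' : X.Opens}
    (i : V ⟶ W) (j : V' ⟶ V) (k : V' ⟶ W) (m : Γ(L, V)) :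
    divGenerator he V' k (L.presheaf.map j.op m) = X.presheaf.map j.op (divGenerator he V i m) := by
  apply divGenerator_eq
  rw [← map_map L i j k, ← Scheme.Modules.map_smul, divGenerator_smul]

/-- The pushforward of the structure sheaf of an open subscheme. -/
def openUnit (W : X.Opens) : X.Modules :=
  (Scheme.Modules.pushforward W.ι).obj (SheafOfModules.unit W.toScheme.ringCatSheaf)

/-- The inclusion of the trace `V ∩ W` into `W`. -/
abbrev traceIncl (W V : X.Opens) : W.ι ''ᵁ W.ι ⁻¹ᵁ V ⟶ W := homOfLE (W.ι_image_le _)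

/-- The inclusion of the trace `V ∩ W` into `V`. -/
abbrev traceIncl' (W V : X.Opens) : W.ι ''ᵁ W.ι ⁻¹ᵁ V ⟶ V := homOfLE (W.ι.image_preimage_le _)

/-- Division by a generator over `W`, as a morphism `L ⟶ j_* 𝒪_W`. -/
def toOpenUnit {W : X.Opens} {e : Γ(L, W)} (he : IsGenerator e) : L ⟶ openUnit W where
  val :=
    -- Sections of `openUnit W` over `V` are by definition functions on `W.ι ''ᵁ W.ι ⁻¹ᵁ V`; this
    -- form of `V ∩ W` is kept to avoid transport along an equality of open sets.
    { app := fun V ↦ ModuleCat.ofHom (Y := (openUnit W).val.obj V)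
        { toFun := fun m ↦ (divGenerator he (W.ι ''ᵁ W.ι ⁻¹ᵁ V.unop) (traceIncl W V.unop)
            (L.presheaf.map (traceIncl' W V.unop).op m))
          map_add' := fun a b ↦ by
            refine (congrArg _ ((L.presheaf.map (traceIncl' W V.unop).op).hom.map_add a b)).trans ?_
            exact _root_.map_add _ _ _
          map_smul' := fun r a ↦ by
            refine (congrArg _ (Scheme.Modules.map_smul L (traceIncl' W V.unop) r a)).trans ?_
            rw [_root_.map_smul]
            rfl }
      naturality := fun {V V'} i ↦ by
        ext m
        exact (congrArg _ ((map_map L i.unop _ (traceIncl' W V'.unop ≫ i.unop) m).trans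
          (map_map L (traceIncl' W V.unop) (homOfLE (W.ι.image_mono
            (W.ι.preimage_mono (leOfHom i.unop)))) _ m).symm)).trans
          (divGenerator_map he _ _ _ _) }

theorem toOpenUnit_app {W : X.Opens} {e : Γ(L, W)} (he : IsGenerator e) (V : X.Opens)
    (m : Γ(L, V)) : (toOpenUnit he).app V m =
      divGenerator he (W.ι ''ᵁ W.ι ⁻¹ᵁ V) (traceIncl W V) (L.presheaf.map (traceIncl' W V).op m) :=
  rfl
end LinePower

namespace LinePower
open SheafSections
variable {X : Scheme.{u}} {L : X.Modules}

theorem toOpenUnit_injective [IsIntegral X] (hL : IsInvertible L) {W : X.Opens} {e : Γ(L, W)}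
    (he : IsGenerator e) (hW : (W : Set X).Nonempty) (V : X.Opens) :
    Function.Injective ((toOpenUnit he).app V) := by
  intro a b hab
  -- The cover of `V` by itself serves only to provide a point of `V`, so that the trace on `W` is
  -- nonempty and restriction to it is injective.
  refine eq_of_locally_eq L _ _ fun x hx ↦ ⟨V, 𝟙 V, hx, ?_⟩
  rw [op_id, CategoryTheory.Functor.map_id]
  apply map_injective hL (traceIncl' W V)
  · rw [Scheme.Hom.image_preimage_eq_opensRange_inf, Scheme.Opens.opensRange_ι]
    exact inf_nonempty hW ⟨x, hx⟩
  · rw [toOpenUnit_app, toOpenUnit_app] at hab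
    have h1 := divGenerator_smul he _ (traceIncl W V) (L.presheaf.map (traceIncl' W V).op a)
    rw [hab] at h1
    exact h1.symm.trans (divGenerator_smul he _ _ _)

theorem mono_toOpenUnit [IsIntegral X] (hL : IsInvertible L) {W : X.Opens} {e : Γ(L, W)}
    (he : IsGenerator e) (hW : (W : Set X).Nonempty) : Mono (toOpenUnit he) where
  right_cancellation a b h := by
    ext U x
    exact toOpenUnit_injective hL he hW U congr(($h).app U x)

/-- Two morphisms to line bundles, the first one an epimorphism, whose ratios agree on a nonempty
open set differ by a morphism of line bundles. -/
theorem exists_desc [IsIntegral X] {L' F : X.Modules} (hL : IsInvertible L) (α : F ⟶ L')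
    (β : F ⟶ L) [Epi α] {W : X.Opens} (hW : (W : Set X).Nonempty) {e : Γ(L, W)} {e' : Γ(L', W)}
    (he : IsGenerator e) (he' : IsGenerator e') (h : β ≫ toOpenUnit he = α ≫ toOpenUnit he') :
    ∃ s : L' ⟶ L, β = α ≫ s := by
  have := mono_toOpenUnit hL he hW
  -- After the monomorphism out of `L`, `β` factors through `α`; hence `β` vanishes on `ker α`, and
  -- `α` is the cokernel of its kernel.
  have hk : Limits.kernel.ι α ≫ β = 0 := by
    rw [← cancel_mono (toOpenUnit he), Category.assoc, h, Limits.kernel.condition_assoc,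
      Limits.zero_comp, Limits.zero_comp]
  exact ⟨Abelian.epiDesc α β hk, (Abelian.comp_epiDesc α β hk).symm⟩

end LinePower

/-! ### Ring homomorphisms describing an induced morphism. -/

namespace AlgebraicGeometry.Scheme.Opens

/-- A morphism to an affine scheme is determined by its effect on global sections; `W` need not be
affine. -/
theorem toSpecΓ_SpecMap_injective {X : Scheme.{u}} (W : X.Opens) {R : CommRingCat.{u}}
    {g g' : R ⟶ Γ(X, W)} (h : W.toSpecΓ ≫ Spec.map g = W.toSpecΓ ≫ Spec.map g') : g = g' := by
  have := congr(($h).appTop)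
  simp only [Scheme.Hom.comp_appTop, toSpecΓ_appTop] at this
  rw [← Category.assoc, ← Category.assoc, cancel_mono, Scheme.ΓSpecIso_naturality,
    Scheme.ΓSpecIso_naturality, cancel_epi] at this
  exact this

end AlgebraicGeometry.Scheme.Opens

namespace GradedQCohAlg
open SheafSections LinePower
variable {S X : Scheme.{u}}

namespace PowerHom
variable {f : X ⟶ S} {A : GradedQCohAlg S} {L : X.Modules} (ψ : PowerHom f A L)

theorem onDegOne_map {U U' : S.Opens} (i : U' ⟶ U) {W W' : X.Opens} (j : W' ⟶ W)
    (h : W ≤ f ⁻¹ᵁ U) (h' : W' ≤ f ⁻¹ᵁ U') (a : A.piece U 1) :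
    ψ.onDegOne h' ((A.deg 1).presheaf.map i.op a) = L.presheaf.map j.op (ψ.onDegOne h a) := by
  unfold onDegOne
  rw [pull_map f (A.deg 1) i j h h', app_map]

/-- A nonzero morphism from a pullback is nonzero on a section pulled back from an affine open. -/
theorem exists_affine_pull_ne_zero {M : X.Modules} {N : S.Modules}
    (β : (Scheme.Modules.pullback f).obj N ⟶ M) (hβ : β ≠ 0) :
    ∃ (U : S.AffineZariskiSite) (a : Γ(N, U.toOpens)), β.app (f ⁻¹ᵁ U.toOpens)
      (pull f N a le_rfl) ≠ 0 := by
  by_contra! H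
  refine hβ (pullback_hom_ext f fun U a ↦ eq_of_locally_eq M _ _ fun x hx ↦ ?_)
  obtain ⟨V, hV, hxV, hVU⟩ := exists_isAffineOpen_mem_and_subset (U := U) (x := f x) hx
  let i : V ⟶ U := homOfLE hVU
  let j : f ⁻¹ᵁ V ⟶ f ⁻¹ᵁ U := (TopologicalSpace.Opens.map f.base).map i
  refine ⟨f ⁻¹ᵁ V, j, hxV, ?_⟩
  have h0 := H ⟨V, hV⟩ (N.presheaf.map i.op a)
  rw [pull_map f N i j le_rfl le_rfl, app_map] at h0
  exact h0.trans (map_zero _).symm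

/-- The degree one part of the description of the morphism induced by `ψ`. -/
theorem Induces.exists_ringHom {ψ : PowerHom f A L} {φ : X ⟶ A.relProj} (hφ : ψ.Induces φ)
    {U : S.AffineZariskiSite} (a : A.piece U.toOpens 1) {W : X.Opens} (h : W ≤ f ⁻¹ᵁ U.toOpens)
    (ha : IsGenerator (ψ.onDegOne h a)) {s : A.Sec U.toOpens} (hs : s ∈ A.part U.toOpens 1)
    (e : s = A.of U.toOpens 1 a) :
    ∃ g : Away (A.part U.toOpens) s →+* Γ(X, W),
      (∀ b : A.piece U.toOpens 1, g (Away.mk (A.part U.toOpens) hs 1 (A.of U.toOpens 1 b)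
            (by simpa using ExtGraded.of_mem b)) • ψ.onDegOne h a = ψ.onDegOne h b) ∧
      W.ι ≫ φ = W.toSpecΓ ≫ Spec.map (CommRingCat.ofHom g) ≫
        Proj.awayι (A.part U.toOpens) s hs one_pos ≫ A.chart U := by
  -- The denominator `s` is a variable because it is later also `ξ.onSec _ _`, which equals a
  -- section of degree one only propositionally.
  subst e
  obtain ⟨g, h1, h2⟩ := hφ U a W h ha
  refine ⟨g, fun b ↦ ?_, h2⟩
  have := congrArg ((powOne L).hom.app W) (h1 1 b)
  rw [Scheme.Modules.Hom.app_smul, powOne_mk_prePow] at this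
  exact this

/-- Compatibility of the local descriptions with restriction. -/
theorem ringHom_res {φ : X ⟶ A.relProj} {V U : S.AffineZariskiSite} (i : V ⟶ U) {W' W : X.Opens}
    (j : W' ⟶ W) {s : A.Sec U.toOpens} (hs : s ∈ A.part U.toOpens 1)
    (g : Away (A.part U.toOpens) s →+* Γ(X, W))
    (g' : Away (A.part V.toOpens) (A.res (incl i) s) →+* Γ(X, W'))
    (h : W.ι ≫ φ = W.toSpecΓ ≫ Spec.map (CommRingCat.ofHom g) ≫
        Proj.awayι (A.part U.toOpens) s hs one_pos ≫ A.chart U)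
    (h' : W'.ι ≫ φ = W'.toSpecΓ ≫ Spec.map (CommRingCat.ofHom g') ≫
        Proj.awayι (A.part V.toOpens) _ (map_mem _ hs) one_pos ≫ A.chart V) :
    (X.presheaf.map j.op).hom.comp g = g'.comp (Away.map (A.res (incl i)) s) := by
  have hj : X.homOfLE (leOfHom j) ≫ W.ι = W'.ι := X.homOfLE_ι _
  rw [← hj, Category.assoc, h, ← A.chart_comp i, Proj.awayι_comp_map_assoc _ _ one_pos s hs,
    ← Scheme.Opens.toSpecΓ_SpecMap_presheaf_map_assoc] at h'
  simp only [← Category.assoc] at h'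
  -- The chart and the inclusion of `D₊(s)` are open immersions, hence monomorphisms, which reduces
  -- the claim to maps into an affine scheme.
  rw [cancel_mono, cancel_mono] at h'
  simp only [Category.assoc, ← Spec.map_comp] at h'
  exact congrArg CommRingCat.Hom.hom (W'.toSpecΓ_SpecMap_injective h')

end PowerHom
end GradedQCohAlg

/-! ### Separatedness of the relative `Proj`, dehomogenization, shrinking affine opens. -/

namespace GradedQCohAlg
variable {S : Scheme.{u}} (A : GradedQCohAlg S)

instance isSeparated_projToSpec (U : S.Opens) : IsSeparated (A.projToSpec U) :=
  inferInstanceAs (IsSeparated (_ ≫ _))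

/-- Separatedness is local on the target, and over an affine open `U` the structure map is `Proj
A(U) ⟶ Spec Γ(S, U)` up to isomorphism. It lets an equality of morphisms spread from a dense open
set. -/
instance isSeparated_relProjToBase : IsSeparated A.relProjToBase := by
  refine IsZariskiLocalAtTarget.of_openCover (P := @IsSeparated)
    (Scheme.AffineZariskiSite.directedCover S) fun (U : S.AffineZariskiSite) ↦ ?_
  have h := A.gluingData.isPullback_natTrans_ι_toBase U
  have h2 : IsSeparated (A.gluingData.natTrans.app U) :=
    inferInstanceAs (IsSeparated (A.projToSpec U.toOpens ≫
      ((Scheme.AffineZariskiSite.restrictIsoSpec S).app U).inv))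
  rw [← h.flip.isoPullback_hom_snd] at h2
  exact (MorphismProperty.cancel_left_of_respectsIso @IsSeparated h.flip.isoPullback.hom
    (Limits.pullback.snd A.gluingData.toBase
      ((Scheme.AffineZariskiSite.directedCover S).f U))).mp h2

section dehom
variable {U : S.Opens} {s : A.Sec U} (hs : s ∈ A.part U 1)

/-- Division of homogeneous sections by powers of a section `s` of degree one. -/
def dehomPart (n : ℕ) : A.piece U n →+ Away (A.part U) s :=
  AddMonoidHom.mk' (fun d ↦ Away.mk (A.part U) hs n (A.of U n d)
    (by simpa using ExtGraded.of_mem d)) fun a b ↦ by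
      ext
      simp only [Away.val_mk, val_add, map_add, Localization.add_mk_self]

/-- The dehomogenization `⨁ n, A_n(U) → A(U)_(s)`, `d ↦ d / s ^ n`. -/
def dehom : A.Sec U →+* Away (A.part U) s :=
  DirectSum.toSemiring (A.dehomPart hs)
    (by
      ext
      simp only [dehomPart, AddMonoidHom.mk'_apply, Away.val_mk, val_one, pow_zero]
      exact Localization.mk_one)
    (fun {m n} a b ↦ by
      ext
      simp only [dehomPart, AddMonoidHom.mk'_apply, Away.val_mk, val_mul, Localization.mk_mul]
      rw [DirectSum.of_mul_of]
      congr 1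
      exact Subtype.ext (pow_add s m n))

theorem dehom_of (n : ℕ) (d : A.piece U n) :
    A.dehom hs (A.of U n d) = Away.mk (A.part U) hs n (A.of U n d)
      (by simpa using ExtGraded.of_mem d) :=
  DirectSum.toSemiring_of _ _ _ _ _

theorem dehom_self (b : A.piece U 1) (e : s = A.of U 1 b) : A.dehom hs (A.of U 1 b) = 1 := by
  subst e
  ext
  simp [dehom_of, Away.val_mk]
end dehom

theorem res_mem_closure {U V : S.Opens} (i : V ⟶ U) {x : A.Sec U}
    (hx : x ∈ Subring.closure (Set.range (A.algMap U) ∪ Set.range (A.of U 1))) :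
    A.res i x ∈ Subring.closure (Set.range (A.algMap V) ∪ Set.range (A.of V 1)) := by
  change (A.res i).toRingHom x ∈ _
  refine Subring.closure_le (t := (Subring.closure _).comap (A.res i).toRingHom) |>.mpr ?_ hx
  rintro _ (⟨r, rfl⟩ | ⟨b, rfl⟩)
  · exact Subring.subset_closure (.inl ⟨_, (A.res_algMap i r).symm⟩)
  · exact Subring.subset_closure (.inr ⟨_, (A.res_of i b).symm⟩)

/-- Arrows of the affine site are inclusions of basic opens, so an affine open can only be shrunk to
some `D(g)`; the next lemma needs an open set that is basic in two affine opens at once. -/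
theorem exists_site_le (U : S.AffineZariskiSite) {V : S.Opens} {x : S} (hU : x ∈ U.toOpens)
    (hV : x ∈ V) : ∃ (U' : S.AffineZariskiSite) (_ : U' ⟶ U), x ∈ U'.toOpens ∧ U'.toOpens ≤ V := by
  obtain ⟨g, hg, hx⟩ := U.2.exists_basicOpen_le ⟨x, hV⟩ hU
  exact ⟨U.basicOpen g, homOfLE (U.basicOpen_le g), hx, hg⟩

theorem exists_site_common (U V : S.AffineZariskiSite) {x : S} (hU : x ∈ U.toOpens)
    (hV : x ∈ V.toOpens) :
    ∃ (U' : S.AffineZariskiSite) (_ : U' ⟶ U) (_ : U' ⟶ V), x ∈ U'.toOpens := by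
  obtain ⟨f, g, e, hx⟩ := exists_basicOpen_le_affine_inter U.2 V.2 x ⟨hU, hV⟩
  exact ⟨U.basicOpen f, homOfLE (U.basicOpen_le f), homOfLE ⟨g, e.symm⟩, hx⟩

/-! ### `P(ξ)` over `S`, and its domain in terms of degree one sections. -/

namespace Hom
variable {A} {B : GradedQCohAlg S} (ξ : Hom A B)

theorem onSec_algMap (U : S.Opens) (r : Γ(S, U)) :
    ξ.onSec U (A.algMap U r) = B.algMap U r := by
  change ξ.onSec U (A.of U 0 _) = B.of U 0 _
  rw [onSec_of, Scheme.Modules.Hom.app_smul, ξ.app_one]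

/-- Both composites come from the structure map of `Γ(S, U)` into degree zero fractions, and `ξ`
respects it. -/
theorem pieceMap_toBase (i : Index A) :
    ξ.pieceMap i ≫ A.relProjToBase = ξ.pieceι i ≫ B.relProjToBase := by
  dsimp only [pieceMap, pieceι]
  simp only [Category.assoc, chart_toBase]
  rw [← Category.assoc (Proj.awayι _ _ _ _), ← Category.assoc (Proj.awayι _ _ _ _),
    awayι_projToSpec, awayι_projToSpec, ← Category.assoc, ← Spec.map_comp]
  congr 2
  exact CommRingCat.hom_ext (RingHom.ext fun r ↦
    GradedLoc.map_fromZero (ξ.onSec _) i.a (A.algMapZero _ r) (B.algMapZero _ r)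
      (ξ.onSec_algMap _ r))

/-- The open immersion of `D₊(ξ a)` into the domain of `P(ξ)`. -/
def pieceToDomain (i : Index A) : ξ.pieceDom i ⟶ ξ.domain.toScheme :=
  SchemeGlue.toUnion ξ.pieceDom ξ.pieceι i

theorem pieceToDomain_ι (i : Index A) : ξ.pieceToDomain i ≫ ξ.domain.ι = ξ.pieceι i :=
  SchemeGlue.toUnion_ι ξ.pieceDom ξ.pieceι i

theorem pieceToDomain_relProjMap (i : Index A) :
    ξ.pieceToDomain i ≫ ξ.relProjMap = ξ.pieceMap i :=
  SchemeGlue.Compatible.toUnion_glue ξ.compatible i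

theorem relProjMap_toBase :
    ξ.relProjMap ≫ A.relProjToBase = ξ.domain.ι ≫ B.relProjToBase := by
  refine (SchemeGlue.unionCover ξ.pieceDom ξ.pieceι).hom_ext _ _ fun (i : Index A) ↦ ?_
  change ξ.pieceToDomain i ≫ _ = ξ.pieceToDomain i ≫ _
  rw [← Category.assoc, pieceToDomain_relProjMap, pieceMap_toBase, ← Category.assoc,
    pieceToDomain_ι]

/-- Near a point of the domain of `P(ξ)`, one finds `a` of degree one. -/
theorem exists_degree_one (hA : A.IsStandardGraded) {y : B.relProj} (hy : y ∈ ξ.domain) :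
    ∃ (V : S.AffineZariskiSite) (b : A.piece V.toOpens 1) (z : Proj (B.part V.toOpens)),
      B.chart V z = y ∧
        z ∈ Proj.basicOpen (B.part V.toOpens) (B.of V.toOpens 1 ((ξ.hom 1).app _ b)) := by
  obtain ⟨i, hi⟩ := TopologicalSpace.Opens.mem_iSup.mp hy
  have hx : B.relProjToBase y ∈ i.U.toOpens := by
    obtain ⟨w, rfl⟩ := hi
    exact (B.preimage_toBase i.U).ge ⟨Proj.awayι _ _ _ _ w, rfl⟩
  obtain ⟨a, ha⟩ := i.mem
  -- Generation in degree one holds only locally on `S`, so `i.U` is shrunk around the image of `y`.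
  obtain ⟨V₀, hxV₀, j, hj⟩ := hA.generated i.U.toOpens i.n a _ hx
  obtain ⟨V, r, hxV, hV⟩ := exists_site_le i.U hx hxV₀
  obtain ⟨z, rfl⟩ : y ∈ (B.chart V).opensRange := (B.preimage_toBase V).le hxV
  have hz := ξ.mem_pieceι_res i r z hi
  by_contra! H
  have hH (b : A.piece V.toOpens 1) : ξ.onSec _ (A.of _ 1 b) ∈ z.asHomogeneousIdeal := by
    rw [onSec_of]
    exact not_not.mp (H V b z rfl)
  have hcl := A.res_mem_closure (homOfLE hV) hj
  have hcomp : A.res (homOfLE hV) (A.res j (A.of _ i.n a)) = A.res (incl r) i.a := by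
    rw [← ha, res_of, res_of, SheafSections.map_map _ _ _ (incl r)]
    exact (A.res_of (incl r) a).symm
  rw [hcomp] at hcl
  -- If all `ξ b` with `b` of degree one lie in the prime `z`, then modulo `z` the image under `ξ`
  -- of the generated subring consists of scalars.
  have key : ∃ t, ξ.onSec _ (A.res (incl r) i.a) - B.algMap V.toOpens t ∈
      z.asHomogeneousIdeal.toIdeal := by
    generalize A.res (incl r) i.a = x at hcl
    induction hcl using Subring.closure_induction with
    | mem x hx =>
      obtain ⟨t, rfl⟩ | ⟨b, rfl⟩ := hx
      · exact ⟨t, by rw [onSec_algMap, sub_self]; exact zero_mem _⟩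
      · exact ⟨0, by rw [map_zero, sub_zero]; exact hH b⟩
    | zero => exact ⟨0, by simp⟩
    | one => exact ⟨1, by simp⟩
    | add x y _ _ hx hy =>
      obtain ⟨t, ht⟩ := hx
      obtain ⟨u, hu⟩ := hy
      refine ⟨t + u, ?_⟩
      rw [map_add, map_add, add_sub_add_comm]
      exact add_mem ht hu
    | neg x _ hx =>
      obtain ⟨t, ht⟩ := hx
      refine ⟨-t, ?_⟩
      rw [map_neg, map_neg, ← neg_sub']
      exact neg_mem ht
    | mul x y _ _ hx hy =>
      obtain ⟨t, ht⟩ := hx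
      obtain ⟨u, hu⟩ := hy
      refine ⟨t * u, ?_⟩
      have : ξ.onSec _ (x * y) - B.algMap V.toOpens (t * u) =
          (ξ.onSec _ x - B.algMap _ t) * ξ.onSec _ y +
            B.algMap _ t * (ξ.onSec _ y - B.algMap _ u) := by
        rw [map_mul, map_mul]
        ring
      rw [this]
      exact add_mem (Ideal.mul_mem_right _ _ ht) (Ideal.mul_mem_left _ _ hu)
  obtain ⟨t, ht⟩ := key
  -- The component of degree `i.n > 0` does not see the scalar `t`, so `ξ a` itself lies in the
  -- homogeneous prime `z`, a contradiction.
  have h1 := z.asHomogeneousIdeal.isHomogeneous i.n ht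
  have hm : ξ.onSec _ (A.res (incl r) i.a) ∈ B.part V.toOpens i.n :=
    map_mem _ (map_mem _ i.mem)
  have ht0 : B.algMap V.toOpens t ∈ B.part V.toOpens 0 := ⟨_, rfl⟩
  rw [DirectSum.decompose_sub, DirectSum.sub_apply, AddSubgroupClass.coe_sub,
    DirectSum.decompose_of_mem_same _ hm, DirectSum.decompose_of_mem_ne _ ht0 i.pos.ne,
    sub_zero] at h1
  exact hz h1

end Hom
end GradedQCohAlg

/-! ### Morphisms in charts, and where a section generates. -/

namespace GradedQCohAlg
open SheafSections LinePower
variable {S X : Scheme.{u}} {A : GradedQCohAlg S}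

/-- On `W`, `φ` lands in `D₊(ξ s)`, one of the pieces from which `P(ξ)` is glued, so composing with
`P(ξ)` amounts to precomposing `g` with the localization of `ξ`. -/
theorem Hom.homOfLE_relProjMap {B : GradedQCohAlg S} (ξ : Hom A B) {φ : X ⟶ B.relProj}
    {V : S.AffineZariskiSite} {s : A.Sec V.toOpens} (hs : s ∈ A.part V.toOpens 1) {W : X.Opens}
    (g : Away (B.part V.toOpens) (ξ.onSec V.toOpens s) →+* Γ(X, W))
    (h : W.ι ≫ φ = W.toSpecΓ ≫ Spec.map (CommRingCat.ofHom g) ≫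
      Proj.awayι (B.part V.toOpens) _ (map_mem _ hs) one_pos ≫ B.chart V) :
    ∃ hW : W ≤ φ ⁻¹ᵁ ξ.domain, X.homOfLE hW ≫ (φ ∣_ ξ.domain) ≫ ξ.relProjMap =
      W.toSpecΓ ≫ Spec.map (CommRingCat.ofHom (g.comp (Away.map (ξ.onSec V.toOpens) s))) ≫
        Proj.awayι (A.part V.toOpens) s hs one_pos ≫ A.chart V := by
  let i : Index A := ⟨V, 1, one_pos, s, hs⟩
  have h' : W.ι ≫ φ = W.toSpecΓ ≫ Spec.map (CommRingCat.ofHom g) ≫ ξ.pieceι i := h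
  have hW : W ≤ φ ⁻¹ᵁ ξ.domain := fun x hx ↦ by
    have := congr($h' ⟨x, hx⟩)
    refine SchemeGlue.le_union ξ.pieceDom ξ.pieceι i
      ⟨Spec.map (CommRingCat.ofHom g) (W.toSpecΓ ⟨x, hx⟩), ?_⟩
    exact this.symm
  have h2 : X.homOfLE hW ≫ (φ ∣_ ξ.domain) = W.toSpecΓ ≫ Spec.map (CommRingCat.ofHom g) ≫
      ξ.pieceToDomain i := by
    rw [← cancel_mono ξ.domain.ι, Category.assoc, morphismRestrict_ι, Scheme.homOfLE_ι_assoc, h']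
    simp only [Category.assoc, pieceToDomain_ι]
  refine ⟨hW, ?_⟩
  rw [← Category.assoc, h2, Category.assoc, Category.assoc, pieceToDomain_relProjMap,
    CommRingCat.ofHom_comp, Spec.map_comp, Category.assoc]
  rfl

theorem eq_of_comp_chart {U : S.AffineZariskiSite} {n : ℕ} (hn : 0 < n) {s : A.Sec U.toOpens}
    (hs : s ∈ A.part U.toOpens n) {W : X.Opens} {g g' : Away (A.part U.toOpens) s →+* Γ(X, W)}
    (h : W.toSpecΓ ≫ Spec.map (CommRingCat.ofHom g) ≫
        Proj.awayι (A.part U.toOpens) s hs hn ≫ A.chart U =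
      W.toSpecΓ ≫ Spec.map (CommRingCat.ofHom g') ≫
        Proj.awayι (A.part U.toOpens) s hs hn ≫ A.chart U) : g = g' := by
  simp only [← Category.assoc] at h
  rw [cancel_mono, cancel_mono] at h
  exact congrArg CommRingCat.Hom.hom (W.toSpecΓ_SpecMap_injective h)

/-- Inside `D₊(s)` the open set `D₊(t)` is the locus where `t/s` is invertible, and `g` pulls this
function back to `W`. Both degrees are one, so the localization element is `t/s` itself. -/
theorem mem_basicOpen_of_chart {φ : X ⟶ A.relProj} {U : S.AffineZariskiSite}
    {s t : A.Sec U.toOpens} (hs : s ∈ A.part U.toOpens 1) (ht : t ∈ A.part U.toOpens 1)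
    {W : X.Opens} (g : Away (A.part U.toOpens) s →+* Γ(X, W))
    (h : W.ι ≫ φ = W.toSpecΓ ≫ Spec.map (CommRingCat.ofHom g) ≫
      Proj.awayι (A.part U.toOpens) s hs one_pos ≫ A.chart U) {x : X} (hx : x ∈ W)
    {z : Proj (A.part U.toOpens)} (hz : A.chart U z = φ x)
    (hzt : z ∈ Proj.basicOpen (A.part U.toOpens) t) :
    x ∈ X.basicOpen (g (Away.mk (A.part U.toOpens) hs 1 t (by simpa using ht))) := by
  set y := Spec.map (CommRingCat.ofHom g) (W.toSpecΓ ⟨x, hx⟩) with hy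
  have h1 : A.chart U (Proj.awayι (A.part U.toOpens) s hs one_pos y) = φ x :=
    congr($h ⟨x, hx⟩).symm
  obtain rfl := (A.chart U).injective (h1.trans hz.symm)
  have h2 : y ∈ PrimeSpectrum.basicOpen (Away.isLocalizationElem hs ht) :=
    (Proj.awayι_preimage_basicOpen (A.part U.toOpens) hs one_pos ht one_pos).le hzt
  have h3 : Away.isLocalizationElem hs ht =
      Away.mk (A.part U.toOpens) hs 1 t (by simpa using ht) := by
    ext
    simp [Away.isLocalizationElem, Away.val_mk]
  rw [h3] at h2
  exact (W.toSpecΓ_preimage_basicOpen _).le (show (⟨x, hx⟩ : W) ∈ _ from h2)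

namespace PowerHom
variable {f : X ⟶ S} {L : X.Modules} {ψ : PowerHom f A L}

/-- If `φ` maps a point near which `ψ(f^* a)` generates `L` into `D₊(b)`, then `ψ(f^* b)` generates
`L` near this point. -/
theorem Induces.exists_isGenerator {φ : X ⟶ A.relProj} (hφ : ψ.Induces φ)
    {U : S.AffineZariskiSite} (a b : A.piece U.toOpens 1) {W : X.Opens} (h : W ≤ f ⁻¹ᵁ U.toOpens)
    (ha : IsGenerator (ψ.onDegOne h a)) {x : X} (hx : x ∈ W) {z : Proj (A.part U.toOpens)}
    (hz : A.chart U z = φ x) (hzb : z ∈ Proj.basicOpen (A.part U.toOpens) (A.of U.toOpens 1 b)) :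
    ∃ (W' : X.Opens) (j : W' ⟶ W), x ∈ W' ∧
      IsGenerator (ψ.onDegOne (j.le.trans h) b) := by
  obtain ⟨g, h1, h2⟩ := hφ.exists_ringHom a h ha (ExtGraded.of_mem a) rfl
  have hxb := mem_basicOpen_of_chart _ (ExtGraded.of_mem b) g h2 hx hz hzb
  -- This is the ratio `ψ(f^* b)/ψ(f^* a)`, invertible at `x` because `φ x` lies in `D₊(b)`.
  set r := g (Away.mk (A.part U.toOpens) (ExtGraded.of_mem a) 1 (A.of U.toOpens 1 b)
    (by simpa using ExtGraded.of_mem b))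
  let j : X.basicOpen r ⟶ W := homOfLE (X.basicOpen_le r)
  refine ⟨X.basicOpen r, j, hxb, ?_⟩
  have h3 := ψ.onDegOne_map (𝟙 _) j h (j.le.trans h) b
  rw [op_id, CategoryTheory.Functor.map_id] at h3
  rw [show ψ.onDegOne (j.le.trans h) b = _ from h3, ← h1 b, Scheme.Modules.map_smul]
  exact (ha.map j).smul (RingedSpace.isUnit_res_basicOpen X.toRingedSpace r)

theorem isGenerator_map {U U' : S.Opens} (i : U' ⟶ U) {W W' : X.Opens} (j : W' ⟶ W)
    {h : W ≤ f ⁻¹ᵁ U} (h' : W' ≤ f ⁻¹ᵁ U') {a : A.piece U 1} (ha : IsGenerator (ψ.onDegOne h a)) :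
    IsGenerator (ψ.onDegOne h' ((A.deg 1).presheaf.map i.op a)) := by
  rw [ψ.onDegOne_map i j h h']
  exact ha.map j

end PowerHom

/-- A nonzero `β` is nonzero on some pulled back section, whose image generates `L` over a nonempty
open set; such a set contains the generic point. -/
theorem exists_isGenerator_of_ne_zero [IsIntegral X] {f : X ⟶ S} {L : X.Modules}
    (hL : IsInvertible L) {N : S.Modules}
    (β : (Scheme.Modules.pullback f).obj N ⟶ L) (hβ : β ≠ 0) :
    ∃ (U : S.AffineZariskiSite) (a : Γ(N, U.toOpens)) (W : X.Opens) (h : W ≤ f ⁻¹ᵁ U.toOpens),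
      genericPoint X ∈ W ∧ IsGenerator (β.app W (pull f N a h)) := by
  obtain ⟨U, a, ha⟩ := PowerHom.exists_affine_pull_ne_zero β hβ
  obtain ⟨W, i, hW, hg⟩ := exists_isGenerator_map hL _ ha
  refine ⟨U, a, W, i.le, ((genericPoint_spec X).mem_open_set_iff W.2).mpr (by simpa using hW), ?_⟩
  have := pull_map f N (𝟙 _) i le_rfl i.le a
  rw [op_id, CategoryTheory.Functor.map_id] at this
  rw [show pull f N a i.le = _ from this, app_map]
  exact hg

theorem ne_zero_of_epi [IsIntegral X] {L F : X.Modules} (hL : IsInvertible L) (α : F ⟶ L)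
    [Epi α] : α ≠ 0 := by
  rintro rfl
  obtain ⟨U, hU, e, he⟩ := hL (genericPoint X)
  have h0 : 𝟙 L = 0 := by rw [← cancel_epi (0 : F ⟶ L)]; simp
  have he0 : e = 0 := congr(($h0).app U e)
  have : Nonempty U := ⟨⟨_, hU⟩⟩
  refine one_ne_zero (α := Γ(X, U)) (he.bijective.1 ?_)
  simp [he0]

/-! ### From equality of morphisms to a homomorphism of line bundles. -/

namespace Hom
variable {A₁ A₂ : GradedQCohAlg S} (ξ : Hom A₂ A₁) {f : X ⟶ S} {L₁ L₂ : X.Modules}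
  {ψ₁ : PowerHom f A₁ L₁} {ψ₂ : PowerHom f A₂ L₂}
  {φ₁ : X ⟶ A₁.relProj} {φ₂ : X ⟶ A₂.relProj}

theorem app_degOne_pull {U : S.Opens} {W : X.Opens} (h : W ≤ f ⁻¹ᵁ U) (a : A₂.piece U 1) :
    ((Scheme.Modules.pullback f).map (ξ.hom 1) ≫ ψ₁.degOne).app W (pull f (A₂.deg 1) a h) =
      ψ₁.onDegOne h ((ξ.hom 1).app U a) :=
  congrArg (ψ₁.degOne.app W) (app_pull f (ξ.hom 1) h a)

/-- The hypothesis `H` identifies the two ring homomorphisms `A₂(V)_(c) → Γ(X, W)`, the one of `φ₂`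
and the one of `φ₁` composed with `ξ`; the common ratio `r` is their value at `a/c`. -/
theorem exists_ratio (hφ₁ : ψ₁.Induces φ₁) (hφ₂ : ψ₂.Induces φ₂)
    (H : (φ₁ ∣_ ξ.domain) ≫ ξ.relProjMap = (φ₁ ⁻¹ᵁ ξ.domain).ι ≫ φ₂)
    {V : S.AffineZariskiSite} (c : A₂.piece V.toOpens 1) {W : X.Opens} (h : W ≤ f ⁻¹ᵁ V.toOpens)
    (h₁ : IsGenerator (ψ₁.onDegOne h ((ξ.hom 1).app _ c))) (h₂ : IsGenerator (ψ₂.onDegOne h c))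
    (a : A₂.piece V.toOpens 1) :
    ∃ r : Γ(X, W), r • ψ₂.onDegOne h c = ψ₂.onDegOne h a ∧
      r • ψ₁.onDegOne h ((ξ.hom 1).app _ c) = ψ₁.onDegOne h ((ξ.hom 1).app _ a) := by
  have hs : A₂.of V.toOpens 1 c ∈ A₂.part V.toOpens 1 := ⟨c, rfl⟩
  obtain ⟨g₂, h2, h2'⟩ := hφ₂.exists_ringHom c h h₂ hs rfl
  obtain ⟨g₁, h1, h1'⟩ := hφ₁.exists_ringHom _ h h₁ (map_mem (ξ.onSec V.toOpens) hs)
    (ξ.onSec_of _ c)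
  obtain ⟨hW, h3⟩ := ξ.homOfLE_relProjMap hs g₁ h1'
  rw [H, Scheme.homOfLE_ι_assoc, h2'] at h3
  have h4 := eq_of_comp_chart one_pos hs h3
  refine ⟨_, h2 a, ?_⟩
  rw [← h1 ((ξ.hom 1).app _ a)]
  congr 1
  refine congr($h4 _).trans ?_
  change g₁ (Away.map _ _ _) = _
  rw [Away.map_mk]
  simp only [onSec_of]

theorem exists_common_generator [IsIntegral X] (hL₁ : IsInvertible L₁) (hL₂ : IsInvertible L₂)
    (hψ₂ : Epi ψ₂.degOne) (hφ₁ : ψ₁.Induces φ₁) (hφ₂ : ψ₂.Induces φ₂)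
    (H : (φ₁ ∣_ ξ.domain) ≫ ξ.relProjMap = (φ₁ ⁻¹ᵁ ξ.domain).ι ≫ φ₂)
    (hβ : (Scheme.Modules.pullback f).map (ξ.hom 1) ≫ ψ₁.degOne ≠ 0) :
    ∃ (V : S.AffineZariskiSite) (c : A₂.piece V.toOpens 1) (W : X.Opens)
      (h : W ≤ f ⁻¹ᵁ V.toOpens), genericPoint X ∈ W ∧ IsGenerator (ψ₂.onDegOne h c) ∧
        IsGenerator (ψ₁.onDegOne h ((ξ.hom 1).app _ c)) := by
  obtain ⟨U, c₀, W₁, hW₁, hη₁, hc₀⟩ := exists_isGenerator_of_ne_zero hL₁ _ hβ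
  -- The section `d₀` is auxiliary: it provides a chart for `φ₂` near the generic point before `c`
  -- is known to generate `L₂`.
  obtain ⟨U', d₀, W₂, hW₂, hη₂, hd₀⟩ :=
    exists_isGenerator_of_ne_zero hL₂ ψ₂.degOne (ne_zero_of_epi hL₂ _)
  rw [app_degOne_pull] at hc₀
  obtain ⟨V, i, i', hV⟩ := exists_site_common U U' (x := f (genericPoint X)) (hW₁ hη₁) (hW₂ hη₂)
  obtain ⟨c, hc'⟩ : ∃ c, c = (A₂.deg 1).presheaf.map (incl i).op c₀ := ⟨_, rfl⟩
  obtain ⟨d, hd'⟩ : ∃ d, d = (A₂.deg 1).presheaf.map (incl i').op d₀ := ⟨_, rfl⟩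
  let W₃ : X.Opens := (W₁ ⊓ W₂) ⊓ f ⁻¹ᵁ V.toOpens
  have hW₃ : W₃ ≤ f ⁻¹ᵁ V.toOpens := inf_le_right
  have hη₃ : genericPoint X ∈ W₃ := ⟨⟨hη₁, hη₂⟩, hV⟩
  have hd : IsGenerator (ψ₂.onDegOne hW₃ d) := by
    rw [hd']
    exact PowerHom.isGenerator_map (incl i') (homOfLE (inf_le_left.trans inf_le_right)) hW₃ hd₀
  have hc : IsGenerator (ψ₁.onDegOne hW₃ ((ξ.hom 1).app _ c)) := by
    rw [hc', app_map]
    exact PowerHom.isGenerator_map (incl i) (homOfLE (inf_le_left.trans inf_le_left)) hW₃ hc₀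
  have hs : A₂.of V.toOpens 1 c ∈ A₂.part V.toOpens 1 := ⟨c, rfl⟩
  obtain ⟨g₁, -, h1⟩ := hφ₁.exists_ringHom _ hW₃ hc (map_mem (ξ.onSec V.toOpens) hs)
    (ξ.onSec_of _ c)
  obtain ⟨hle, h3⟩ := ξ.homOfLE_relProjMap hs g₁ h1
  rw [H, Scheme.homOfLE_ι_assoc] at h3
  obtain ⟨y, hy⟩ : ∃ y, y = Spec.map (CommRingCat.ofHom (g₁.comp (Away.map (ξ.onSec V.toOpens) _)))
      (W₃.toSpecΓ ⟨_, hη₃⟩) := ⟨_, rfl⟩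
  -- By `H`, `φ₂` maps the generic point into `D₊(c)`, so generation passes from `d` to `c`.
  obtain ⟨W, j, hη, hc₂⟩ := hφ₂.exists_isGenerator d c hW₃ hd hη₃
    (z := Proj.awayι (A₂.part V.toOpens) _ hs one_pos y)
    (by rw [hy]; exact congr($h3 ⟨_, hη₃⟩).symm)
    (by rw [← Proj.opensRange_awayι _ _ hs one_pos]; exact ⟨y, rfl⟩)
  refine ⟨V, c, W, _, hη, hc₂, ?_⟩
  have := PowerHom.isGenerator_map (𝟙 _) j (j.le.trans hW₃) hc
  rwa [op_id, CategoryTheory.Functor.map_id] at this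

/-- An equality of functions on `T = W ∩ f⁻¹(U₀)` can be tested near the generic point, where `U₀`
may be replaced by a basic open of `V` and `exists_ratio` applies. `T` is a variable since
`toOpenUnit` presents this intersection as an image of a preimage. -/
theorem divGenerator_onDegOne_eq [IsIntegral X] (hφ₁ : ψ₁.Induces φ₁) (hφ₂ : ψ₂.Induces φ₂)
    (H : (φ₁ ∣_ ξ.domain) ≫ ξ.relProjMap = (φ₁ ⁻¹ᵁ ξ.domain).ι ≫ φ₂)
    {V : S.AffineZariskiSite} (c : A₂.piece V.toOpens 1) {W : X.Opens} (h : W ≤ f ⁻¹ᵁ V.toOpens)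
    (hη : genericPoint X ∈ W)
    (hc₁ : IsGenerator (ψ₁.onDegOne h ((ξ.hom 1).app _ c))) (hc₂ : IsGenerator (ψ₂.onDegOne h c))
    {U₀ : S.Opens} (a : A₂.piece U₀ 1) {T : X.Opens} (t₁ : T ⟶ W) (t₂ : T ⟶ f ⁻¹ᵁ U₀)
    (hT : W ⊓ f ⁻¹ᵁ U₀ ≤ T) :
    divGenerator hc₁ T t₁ (L₁.presheaf.map t₂.op (ψ₁.onDegOne le_rfl ((ξ.hom 1).app U₀ a))) =
      divGenerator hc₂ T t₁ (L₂.presheaf.map t₂.op (ψ₂.onDegOne le_rfl a)) := by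
  by_cases hU₀ : f (genericPoint X) ∈ U₀
  · obtain ⟨V', k, hηV', hV'⟩ := exists_site_le V (h hη) hU₀
    let W' : X.Opens := W ⊓ f ⁻¹ᵁ V'.toOpens
    have hW' : W' ≤ f ⁻¹ᵁ V'.toOpens := inf_le_right
    let l : W' ⟶ W := homOfLE inf_le_left
    let m : W' ⟶ f ⁻¹ᵁ U₀ := homOfLE (inf_le_right.trans (f.preimage_mono hV'))
    let t : W' ⟶ T := homOfLE ((le_inf l.le m.le).trans hT)
    have hne : Nonempty W' := ⟨⟨genericPoint X, hη, hηV'⟩⟩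
    apply map_injective_of_isIntegral X t
    have e₁ := ψ₁.onDegOne_map (incl k) l h hW' ((ξ.hom 1).app _ c)
    have e₂ := ψ₂.onDegOne_map (incl k) l h hW' c
    rw [← app_map] at e₁
    obtain ⟨r, hr₂, hr₁⟩ := ξ.exists_ratio hφ₁ hφ₂ H
      ((A₂.deg 1).presheaf.map (incl k).op c) hW' (e₁ ▸ hc₁.map l) (e₂ ▸ hc₂.map l)
      ((A₂.deg 1).presheaf.map (homOfLE hV').op a)
    rw [← divGenerator_map hc₁ _ t l, ← divGenerator_map hc₂ _ t l, map_map _ _ _ m,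
      map_map _ _ _ m, ← ψ₁.onDegOne_map (homOfLE hV') m le_rfl hW',
      ← ψ₂.onDegOne_map (homOfLE hV') m le_rfl hW', ← app_map]
    rw [divGenerator_eq hc₁ (r := r), divGenerator_eq hc₂ (r := r)]
    · rw [← e₂]; exact hr₂
    · rw [← e₁]; exact hr₁
  -- A nonempty `T` would contain the generic point, so here `T` is empty and carries only the zero
  -- function.
  · have hbot : T = ⊥ := by
      rw [← TopologicalSpace.Opens.coe_eq_empty, Set.eq_empty_iff_forall_notMem]
      intro x hx
      exact hU₀ (((genericPoint_spec X).mem_open_set_iff (f ⁻¹ᵁ U₀).2).mpr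
        ⟨x, trivial, t₂.le hx⟩)
    have : Subsingleton Γ(X, T) := by
      rw [hbot]; infer_instance
    exact Subsingleton.elim _ _

theorem comp_toOpenUnit_eq [IsIntegral X] (hφ₁ : ψ₁.Induces φ₁) (hφ₂ : ψ₂.Induces φ₂)
    (H : (φ₁ ∣_ ξ.domain) ≫ ξ.relProjMap = (φ₁ ⁻¹ᵁ ξ.domain).ι ≫ φ₂)
    {V : S.AffineZariskiSite} (c : A₂.piece V.toOpens 1) {W : X.Opens} (h : W ≤ f ⁻¹ᵁ V.toOpens)
    (hη : genericPoint X ∈ W)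
    (hc₁ : IsGenerator (ψ₁.onDegOne h ((ξ.hom 1).app _ c))) (hc₂ : IsGenerator (ψ₂.onDegOne h c)) :
    ((Scheme.Modules.pullback f).map (ξ.hom 1) ≫ ψ₁.degOne) ≫ toOpenUnit hc₁ =
      ψ₂.degOne ≫ toOpenUnit hc₂ := by
  refine pullback_hom_ext f fun U₀ a ↦ ?_
  have h1 := toOpenUnit_app hc₁ (f ⁻¹ᵁ U₀)
    (ψ₁.onDegOne le_rfl ((ξ.hom 1).app U₀ a))
  have h2 := toOpenUnit_app hc₂ (f ⁻¹ᵁ U₀) (ψ₂.onDegOne le_rfl a)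
  refine (congrArg ((toOpenUnit hc₁).app _) (ξ.app_degOne_pull (ψ₁ := ψ₁) le_rfl a)).trans
    (h1.trans (Eq.trans ?_ h2.symm))
  refine ξ.divGenerator_onDegOne_eq hφ₁ hφ₂ H c h hη hc₁ hc₂ a _ _ ?_
  rw [Scheme.Hom.image_preimage_eq_opensRange_inf, Scheme.Opens.opensRange_ι]

theorem exists_hom_of_eq [IsIntegral X] (hL₁ : IsInvertible L₁) (hL₂ : IsInvertible L₂)
    (hψ₂ : Epi ψ₂.degOne) (hφ₁ : ψ₁.Induces φ₁) (hφ₂ : ψ₂.Induces φ₂)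
    (H : (φ₁ ∣_ ξ.domain) ≫ ξ.relProjMap = (φ₁ ⁻¹ᵁ ξ.domain).ι ≫ φ₂) :
    ∃ s : L₂ ⟶ L₁, (Scheme.Modules.pullback f).map (ξ.hom 1) ≫ ψ₁.degOne = ψ₂.degOne ≫ s := by
  -- When `β = 0` no `ψ₁(ξ c)` can generate `L₁` at the generic point, so this case is settled by `s
  -- = 0`.
  by_cases hβ : (Scheme.Modules.pullback f).map (ξ.hom 1) ≫ ψ₁.degOne = 0
  · exact ⟨0, by rw [hβ, Limits.comp_zero]⟩
  obtain ⟨V, c, W, h, hη, hc₂, hc₁⟩ := ξ.exists_common_generator hL₁ hL₂ hψ₂ hφ₁ hφ₂ H hβ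
  exact exists_desc hL₁ ψ₂.degOne _ ⟨_, hη⟩ hc₁ hc₂
    (ξ.comp_toOpenUnit_eq hφ₁ hφ₂ H c h hη hc₁ hc₂)

end Hom
end GradedQCohAlg

/-! ### From a homomorphism of line bundles to equality of morphisms. -/

namespace GradedQCohAlg
open SheafSections LinePower
variable {S X : Scheme.{u}}

theorem ringHom_res_mk {A : GradedQCohAlg S} {φ : X ⟶ A.relProj} {V U : S.AffineZariskiSite}
    (i : V ⟶ U) {W' W : X.Opens} (j : W' ⟶ W) {s : A.Sec U.toOpens} (hs : s ∈ A.part U.toOpens 1)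
    {s' : A.Sec V.toOpens} (hs' : s' ∈ A.part V.toOpens 1) (e : s' = A.res (incl i) s)
    (g : Away (A.part U.toOpens) s →+* Γ(X, W)) (g' : Away (A.part V.toOpens) s' →+* Γ(X, W'))
    (h : W.ι ≫ φ = W.toSpecΓ ≫ Spec.map (CommRingCat.ofHom g) ≫
        Proj.awayι (A.part U.toOpens) s hs one_pos ≫ A.chart U)
    (h' : W'.ι ≫ φ = W'.toSpecΓ ≫ Spec.map (CommRingCat.ofHom g') ≫
        Proj.awayι (A.part V.toOpens) s' hs' one_pos ≫ A.chart V)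
    (n : ℕ) (d : A.Sec U.toOpens) (hd : d ∈ A.part U.toOpens (n • 1)) :
    X.presheaf.map j.op (g (Away.mk (A.part U.toOpens) hs n d hd)) =
      g' (Away.mk (A.part V.toOpens) hs' n (A.res (incl i) d) (map_mem _ hd)) := by
  subst e
  refine congr($(PowerHom.ringHom_res i j hs g g' h h') _).trans ?_
  rw [RingHom.comp_apply, Away.map_mk]

namespace Hom
variable {A₁ A₂ : GradedQCohAlg S} (ξ : Hom A₂ A₁) {f : X ⟶ S} {L₁ L₂ : X.Modules}
  {ψ₁ : PowerHom f A₁ L₁} {ψ₂ : PowerHom f A₂ L₂}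
  {φ₁ : X ⟶ A₁.relProj} {φ₂ : X ⟶ A₂.relProj} {σ : L₂ ⟶ L₁}

theorem onDegOne_eq
    (hσ : (Scheme.Modules.pullback f).map (ξ.hom 1) ≫ ψ₁.degOne = ψ₂.degOne ≫ σ)
    {U : S.Opens} {W : X.Opens} (h : W ≤ f ⁻¹ᵁ U) (a : A₂.piece U 1) :
    ψ₁.onDegOne h ((ξ.hom 1).app U a) = σ.app W (ψ₂.onDegOne h a) :=
  (ξ.app_degOne_pull h a).symm.trans congr(($hσ).app W (pull f (A₂.deg 1) a h))

/-- Dividing by powers of `b` turns both sides into ring homomorphisms `T₁`, `T₂` on all of `A₂(U)`,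
so it suffices to compare them on scalars and on degree one. -/
theorem ringHom_eq_of_mem_closure
    (hσ : (Scheme.Modules.pullback f).map (ξ.hom 1) ≫ ψ₁.degOne = ψ₂.degOne ≫ σ)
    {U : S.Opens} {W : X.Opens} (h : W ≤ f ⁻¹ᵁ U) (b : A₂.piece U 1)
    (hb : IsGenerator (ψ₁.onDegOne h ((ξ.hom 1).app U b)))
    {s : A₂.Sec U} (hs : s ∈ A₂.part U 1) (e : s = A₂.of U 1 b)
    (g₁ : Away (A₁.part U) (ξ.onSec U s) →+* Γ(X, W)) (g₂ : Away (A₂.part U) s →+* Γ(X, W))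
    (h₁ : ∀ a : A₁.piece U 1, g₁ (Away.mk (A₁.part U) (map_mem (ξ.onSec U) hs) 1 (A₁.of U 1 a)
      (by simpa using ExtGraded.of_mem a)) • ψ₁.onDegOne h ((ξ.hom 1).app U b) = ψ₁.onDegOne h a)
    (h₂ : ∀ a : A₂.piece U 1, g₂ (Away.mk (A₂.part U) hs 1 (A₂.of U 1 a)
      (by simpa using ExtGraded.of_mem a)) • ψ₂.onDegOne h b = ψ₂.onDegOne h a)
    {n : ℕ} {d : A₂.Sec U} (hd : d ∈ A₂.part U n)
    (hcl : d ∈ Subring.closure (Set.range (A₂.algMap U) ∪ Set.range (A₂.of U 1))) :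
    g₁ (Away.mk (A₁.part U) (map_mem (ξ.onSec U) hs) n (ξ.onSec U d)
        (by simpa using map_mem (ξ.onSec U) hd)) =
      g₂ (Away.mk (A₂.part U) hs n d (by simpa using hd)) := by
  let T₁ : A₂.Sec U →+* Γ(X, W) :=
    (g₁.comp (A₁.dehom (map_mem (ξ.onSec U) hs))).comp (ξ.onSec U).toRingHom
  let T₂ : A₂.Sec U →+* Γ(X, W) := g₂.comp (A₂.dehom hs)
  have hT₁ (m : ℕ) (a : A₂.piece U m) : T₁ (A₂.of U m a) = g₁ (Away.mk (A₁.part U)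
      (map_mem (ξ.onSec U) hs) m (A₁.of U m ((ξ.hom m).app U a))
      (by simpa using ExtGraded.of_mem _)) := by
    change g₁ (A₁.dehom _ (ξ.onSec U (A₂.of U m a))) = _
    rw [onSec_of, dehom_of]
  have hT₂ (m : ℕ) (a : A₂.piece U m) : T₂ (A₂.of U m a) = g₂ (Away.mk (A₂.part U)
      hs m (A₂.of U m a) (by simpa using ExtGraded.of_mem _)) := by
    change g₂ (A₂.dehom _ (A₂.of U m a)) = _
    rw [dehom_of]
  have hone (a : A₂.piece U 1) : T₁ (A₂.of U 1 a) = T₂ (A₂.of U 1 a) := by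
    -- Both values are compared after multiplying by the generator `ψ₁(ξ b) = σ(ψ₂ b)`; linearity of
    -- `σ` turns `ψ₂ a` into `ψ₁(ξ a)`.
    refine hb.bijective.1 ?_
    change _ • _ = _ • _
    rw [hT₁, hT₂, h₁, ξ.onDegOne_eq hσ h b, ← Scheme.Modules.Hom.app_smul, h₂,
      ξ.onDegOne_eq hσ h a]
  have hself : T₂ (A₂.of U 1 b) = 1 := by
    change g₂ (A₂.dehom hs _) = 1
    rw [A₂.dehom_self hs b e, map_one]
  have hzero (r : Γ(S, U)) : T₁ (A₂.algMap U r) = T₂ (A₂.algMap U r) := by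
    -- Scalars reduce to degree one through `r • b`, as `b` itself dehomogenizes to `1`.
    have := hone (r • b)
    rwa [← algMap_mul_of, map_mul, map_mul, hone b, hself, mul_one, mul_one] at this
  have key : T₁ d = T₂ d := by
    refine RingHom.eqOn_set_closure (f := T₁) (g := T₂) ?_ hcl
    rintro _ (⟨r, rfl⟩ | ⟨a, rfl⟩)
    · exact hzero r
    · exact hone a
  obtain ⟨d, rfl⟩ := hd
  simp only [onSec_of]
  rw [← hT₁, ← hT₂, key]

/-- A given `d` is a polynomial in degree one sections only after shrinking `U` around the image of
the generic point. This is harmless: functions on `W` inject into functions on the smaller nonempty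
open set. -/
theorem ringHom_eq [IsIntegral X] (hA₂ : A₂.IsStandardGraded)
    (hσ : (Scheme.Modules.pullback f).map (ξ.hom 1) ≫ ψ₁.degOne = ψ₂.degOne ≫ σ)
    (hφ₁ : ψ₁.Induces φ₁) (hφ₂ : ψ₂.Induces φ₂)
    {U : S.AffineZariskiSite} {W : X.Opens} (h : W ≤ f ⁻¹ᵁ U.toOpens) (hη : genericPoint X ∈ W)
    (b : A₂.piece U.toOpens 1)
    (hb₁ : IsGenerator (ψ₁.onDegOne h ((ξ.hom 1).app _ b)))
    (hb₂ : IsGenerator (ψ₂.onDegOne h b))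
    {s : A₂.Sec U.toOpens} (hs : s ∈ A₂.part U.toOpens 1) (e : s = A₂.of U.toOpens 1 b)
    (g₁ : Away (A₁.part U.toOpens) (ξ.onSec U.toOpens s) →+* Γ(X, W))
    (g₂ : Away (A₂.part U.toOpens) s →+* Γ(X, W))
    (h₁ : W.ι ≫ φ₁ = W.toSpecΓ ≫ Spec.map (CommRingCat.ofHom g₁) ≫
      Proj.awayι (A₁.part U.toOpens) _ (map_mem _ hs) one_pos ≫ A₁.chart U)
    (h₂ : W.ι ≫ φ₂ = W.toSpecΓ ≫ Spec.map (CommRingCat.ofHom g₂) ≫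
      Proj.awayι (A₂.part U.toOpens) s hs one_pos ≫ A₂.chart U) :
    g₁.comp (Away.map (ξ.onSec U.toOpens) s) = g₂ := by
  ext x
  obtain ⟨n, d, hd, rfl⟩ := Away.mk_surjective (A₂.part U.toOpens) hs x
  have hd' : d ∈ A₂.part U.toOpens n := by simpa using hd
  obtain ⟨a, ha⟩ := hd'
  obtain ⟨V₀, hxV₀, j, hj⟩ := hA₂.generated U.toOpens n a _ (h hη)
  obtain ⟨V, r, hxV, hV⟩ := exists_site_le U (h hη) hxV₀
  have hcl : A₂.res (incl r) d ∈
      Subring.closure (Set.range (A₂.algMap V.toOpens) ∪ Set.range (A₂.of V.toOpens 1)) := by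
    have := A₂.res_mem_closure (homOfLE hV) hj
    rwa [res_of, res_of, SheafSections.map_map _ _ _ (incl r), ← res_of, ha] at this
  let W' : X.Opens := W ⊓ f ⁻¹ᵁ V.toOpens
  have hW' : W' ≤ f ⁻¹ᵁ V.toOpens := inf_le_right
  let l : W' ⟶ W := homOfLE inf_le_left
  have hne : Nonempty W' := ⟨⟨genericPoint X, hη, hxV⟩⟩
  apply map_injective_of_isIntegral X l
  have hb₁' := PowerHom.isGenerator_map (incl r) l hW' hb₁
  rw [← app_map] at hb₁'
  have hb₂' := PowerHom.isGenerator_map (incl r) l hW' hb₂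
  have hs' := map_mem (A₂.res (incl r)) hs
  have e' : A₂.res (incl r) s = A₂.of V.toOpens 1 ((A₂.deg 1).presheaf.map (incl r).op b) := by
    rw [e, res_of]
  obtain ⟨g₁', k₁, h₁'⟩ := hφ₁.exists_ringHom _ hW' hb₁' (map_mem (ξ.onSec V.toOpens) hs')
    (by rw [e', onSec_of])
  obtain ⟨g₂', k₂, h₂'⟩ := hφ₂.exists_ringHom _ hW' hb₂' hs' e'
  rw [ringHom_res_mk r l hs hs' rfl g₂ g₂' h₂ h₂', RingHom.comp_apply, Away.map_mk,
    ringHom_res_mk r l (map_mem (ξ.onSec _) hs) (map_mem (ξ.onSec _) hs')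
      (ξ.res_onSec (incl r) s).symm g₁ g₁' h₁ h₁']
  simp only [ξ.res_onSec]
  exact ξ.ringHom_eq_of_mem_closure hσ hW' _ hb₁' hs' e' g₁' g₂' k₁ k₂
    (map_mem (A₂.res (incl r)) (show d ∈ A₂.part U.toOpens n by simpa using hd)) hcl

theorem exists_generator_of_mem_domain [IsIntegral X] (hA₂ : A₂.IsStandardGraded)
    (hL₁ : IsInvertible L₁) (hL₂ : IsInvertible L₂) (hψ₁ : Epi ψ₁.degOne)
    (hφ₁S : φ₁ ≫ A₁.relProjToBase = f) (hφ₁ : ψ₁.Induces φ₁)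
    (hσ : (Scheme.Modules.pullback f).map (ξ.hom 1) ≫ ψ₁.degOne = ψ₂.degOne ≫ σ)
    (hη : φ₁ (genericPoint X) ∈ ξ.domain) :
    ∃ (V : S.AffineZariskiSite) (b : A₂.piece V.toOpens 1) (W : X.Opens)
      (h : W ≤ f ⁻¹ᵁ V.toOpens), genericPoint X ∈ W ∧ IsGenerator (ψ₂.onDegOne h b) ∧
        IsGenerator (ψ₁.onDegOne h ((ξ.hom 1).app _ b)) := by
  obtain ⟨U, b₀, z₀, hz₀, hzb₀⟩ := ξ.exists_degree_one hA₂ hη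
  obtain ⟨U', c₀, W₀, hW₀, hη₀, hc₀⟩ :=
    exists_isGenerator_of_ne_zero hL₁ ψ₁.degOne (ne_zero_of_epi hL₁ _)
  have hU : f (genericPoint X) ∈ U.toOpens := by
    have : φ₁ (genericPoint X) ∈ A₁.relProjToBase ⁻¹ᵁ U.toOpens :=
      (A₁.preimage_toBase U).ge ⟨z₀, hz₀⟩
    rw [← hφ₁S]
    exact this
  obtain ⟨V, i, i', hV⟩ := exists_site_common U U' hU (hW₀ hη₀)
  obtain ⟨z, hz⟩ : φ₁ (genericPoint X) ∈ (A₁.chart V).opensRange := by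
    refine (A₁.preimage_toBase V).le ?_
    rw [← hφ₁S] at hV
    exact hV
  have hzz : Proj.map (A₁.res (incl i)) (A₁.res_irrelevant i) z = z₀ := by
    apply (A₁.chart U).injective
    rw [hz₀, ← hz, ← A₁.chart_comp i]
    rfl
  obtain ⟨b, hb⟩ : ∃ b, b = (A₂.deg 1).presheaf.map (incl i).op b₀ := ⟨_, rfl⟩
  obtain ⟨c, hc⟩ : ∃ c, c = (A₁.deg 1).presheaf.map (incl i').op c₀ := ⟨_, rfl⟩
  have hzb : z ∈ Proj.basicOpen (A₁.part V.toOpens) (A₁.of V.toOpens 1 ((ξ.hom 1).app _ b)) := by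
    rw [hb, app_map, ← res_of, ← Proj.map_preimage_basicOpen _ (A₁.res_irrelevant i)]
    change Proj.map (A₁.res (incl i)) (A₁.res_irrelevant i) z ∈
      Proj.basicOpen (A₁.part U.toOpens) (A₁.of U.toOpens 1 ((ξ.hom 1).app _ b₀))
    rw [hzz]
    exact hzb₀
  let W₁ : X.Opens := W₀ ⊓ f ⁻¹ᵁ V.toOpens
  have hW₁ : W₁ ≤ f ⁻¹ᵁ V.toOpens := inf_le_right
  have hc₁ : IsGenerator (ψ₁.onDegOne hW₁ c) := by
    rw [hc]
    exact PowerHom.isGenerator_map (incl i') (homOfLE inf_le_left) hW₁ hc₀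
  -- As `φ₁` maps the generic point into `D₊(ξ b)`, the section `ψ₁(ξ b)` generates `L₁` near it.
  obtain ⟨W₂, j, hη₂, hb₂⟩ := hφ₁.exists_isGenerator c _ hW₁ hc₁
    (x := genericPoint X) ⟨hη₀, hV⟩ hz hzb
  -- A generator of `L₁` over a nonempty open set is nonzero, and here it is `σ(ψ₂ b)`.
  have hne : ψ₂.onDegOne (j.le.trans hW₁) b ≠ 0 := by
    intro h0
    rw [ξ.onDegOne_eq hσ, h0, map_zero] at hb₂
    have : Nonempty W₂ := ⟨⟨_, hη₂⟩⟩
    refine one_ne_zero (α := Γ(X, W₂)) (hb₂.bijective.1 ?_)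
    simp
  obtain ⟨W, k, hW, hb₃⟩ := exists_isGenerator_map hL₂ _ hne
  refine ⟨V, b, W, k.le.trans (j.le.trans hW₁),
    ((genericPoint_spec X).mem_open_set_iff W.2).mpr (by simpa using hW), ?_, ?_⟩
  · have := ψ₂.onDegOne_map (𝟙 _) k (j.le.trans hW₁) (k.le.trans (j.le.trans hW₁)) b
    rw [op_id, CategoryTheory.Functor.map_id] at this
    exact this ▸ hb₃
  · have := PowerHom.isGenerator_map (𝟙 _) k (k.le.trans (j.le.trans hW₁)) hb₂
    rwa [op_id, CategoryTheory.Functor.map_id] at this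

theorem eq_of_hom [IsIntegral X] (hA₂ : A₂.IsStandardGraded)
    (hL₁ : IsInvertible L₁) (hL₂ : IsInvertible L₂) (hψ₁ : Epi ψ₁.degOne)
    (hφ₁S : φ₁ ≫ A₁.relProjToBase = f) (hφ₂S : φ₂ ≫ A₂.relProjToBase = f)
    (hφ₁ : ψ₁.Induces φ₁) (hφ₂ : ψ₂.Induces φ₂)
    (hσ : (Scheme.Modules.pullback f).map (ξ.hom 1) ≫ ψ₁.degOne = ψ₂.degOne ≫ σ) :
    (φ₁ ∣_ ξ.domain) ≫ ξ.relProjMap = (φ₁ ⁻¹ᵁ ξ.domain).ι ≫ φ₂ := by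
  by_cases hη : φ₁ (genericPoint X) ∈ ξ.domain
  · obtain ⟨V, b, W, h, hηW, hb₂, hb₁⟩ :=
      ξ.exists_generator_of_mem_domain hA₂ hL₁ hL₂ hψ₁ hφ₁S hφ₁ hσ hη
    have hs : A₂.of V.toOpens 1 b ∈ A₂.part V.toOpens 1 := ⟨b, rfl⟩
    obtain ⟨g₁, -, h₁⟩ := hφ₁.exists_ringHom _ h hb₁ (map_mem (ξ.onSec V.toOpens) hs)
      (ξ.onSec_of _ b)
    obtain ⟨g₂, -, h₂⟩ := hφ₂.exists_ringHom _ h hb₂ hs rfl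
    obtain ⟨hW, h3⟩ := ξ.homOfLE_relProjMap hs g₁ h₁
    rw [ξ.ringHom_eq hA₂ hσ hφ₁ hφ₂ h hηW b hb₁ hb₂ hs rfl g₁ g₂ h₁ h₂, ← h₂,
      ← Scheme.homOfLE_ι _ hW, Category.assoc] at h3
    have : Nonempty (φ₁ ⁻¹ᵁ ξ.domain) := ⟨⟨_, hη⟩⟩
    have : Nonempty W := ⟨⟨_, hηW⟩⟩
    -- `W` is a nonempty open subset of an irreducible space, hence dense; equality on it extends
    -- because the source is reduced and `Proj A₂` is separated over `S`.
    have : IsDominant (X.homOfLE hW) :=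
      ⟨((X.homOfLE hW).isOpenEmbedding.isOpen_range.dense (Set.range_nonempty _))⟩
    refine ext_of_isDominant_of_isSeparated A₂.relProjToBase ?_ (X.homOfLE hW) h3
    rw [Category.assoc, Category.assoc, relProjMap_toBase, morphismRestrict_ι_assoc, hφ₁S, hφ₂S]
  -- A nonempty open subset of `X` would contain the generic point, so both morphisms have empty
  -- source.
  · have : IsEmpty (φ₁ ⁻¹ᵁ ξ.domain) := ⟨fun x ↦ hη
      (((genericPoint_spec X).mem_open_set_iff (φ₁ ⁻¹ᵁ ξ.domain).2).mpr ⟨x.1, trivial, x.2⟩)⟩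
    exact (isInitialOfIsEmpty (X := (φ₁ ⁻¹ᵁ ξ.domain).toScheme)).hom_ext _ _

end Hom
end GradedQCohAlg

end

theorem theorem2p1 {S X : Scheme.{u}} [AlgebraicGeometry.IsNoetherian S]
    [IsIntegral X] [AlgebraicGeometry.IsNoetherian X] (f : X ⟶ S)
    (A₁ A₂ : GradedQCohAlg S) (hA₁ : A₁.IsStandardGraded) (hA₂ : A₂.IsStandardGraded)
    (L₁ L₂ : X.Modules) (hL₁ : LinePower.IsInvertible L₁) (hL₂ : LinePower.IsInvertible L₂)
    (ψ₁ : GradedQCohAlg.PowerHom f A₁ L₁) (ψ₂ : GradedQCohAlg.PowerHom f A₂ L₂)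
    (hψ₁ : Epi ψ₁.degOne) (hψ₂ : Epi ψ₂.degOne)
    (φ₁ : X ⟶ A₁.relProj) (φ₂ : X ⟶ A₂.relProj)
    (hφ₁S : φ₁ ≫ A₁.relProjToBase = f) (hφ₂S : φ₂ ≫ A₂.relProjToBase = f)
    (hφ₁ : ψ₁.Induces φ₁) (hφ₂ : ψ₂.Induces φ₂)
    (ξ : GradedQCohAlg.Hom A₂ A₁) :
    (φ₁ ∣_ ξ.domain) ≫ ξ.relProjMap = (φ₁ ⁻¹ᵁ ξ.domain).ι ≫ φ₂ ↔
      ∃ s : L₂ ⟶ L₁,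
        (Scheme.Modules.pullback f).map (ξ.hom 1) ≫ ψ₁.degOne = ψ₂.degOne ≫ s :=
  ⟨fun H ↦ ξ.exists_hom_of_eq hL₁ hL₂ hψ₂ hφ₁ hφ₂ H,
    fun ⟨_, hσ⟩ ↦ ξ.eq_of_hom hA₂ hL₁ hL₂ hψ₁ hφ₁S hφ₂S hφ₁ hφ₂ hσ⟩
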